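/- Consider the infinite system of ordinary differential equations $\mathbf p'(t)=\mathcal F[\mathbf p(t)]$, $t\ge 0$, for a probability distribution $\mathbf p(t)=\{p_n(t)\}_{n\ge 0}$ on $\mathbb N=\{0,1,2,\dots\}$, where, with $A[\mathbf q]=\sum_{k\ge 2}kq_k$, $$\mathcal F[\mathbf q]_0=-A[\mathbf q]\,q_0,\qquad \mathcal F[\mathbf q]_1=2q_2-A[\mathbf q](q_1-q_0),$$ $$\mathcal F[\mathbf q]_n=(n+1)q_{n+1}-nq_n-A[\mathbf q](q_n-q_{n-1})\quad(n\ge 2).$$ A classical solution is a curve $\mathbf p$ on $[0,\infty)$ of probability distributions on $\mathbb N$ with finite mean which is continuous with respect to the norm $\sum_{n}(1+n)|q_n|$, continuously differentiable with values in $\ell^\infty$ (one-sided at $t=0$), and satisfies the system for all $t\ge 0$. For such a solution put $a(t)=\sum_{n\ge 2}np_n(t)$. Let $\mu>1$ and $\nu=\mu+W_0(-\mu e^{-\mu})$, where $W_0$ is the principal branch of the Lambert function: for $x\ge -e^{-1}$, $W_0(x)$ is the unique $y\ge -1$ with $ye^y=x$. Write $\langle t\rangle=\sqrt{1+t^2}$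 and, for $t\ge 0$, $$v(t)=\exp\Big(\int_0^t e^{-t+s}a(s)\,ds\Big),\qquad y_2(t)=\int_0^t|v(s)-e^\nu|\,e^{-2t+2s}\,ds .$$ (i) If $\nu<1$, there is a constant $C>0$ depending only on $\mu$ such that for every classical solution $\mathbf p$ whose initial value $\mathbf p(0)$ has mean $\sum_n np_n(0)=\mu$, the function $v$ is differentiable on $[0,\infty)$ (one-sidedly at $t=0$) and, for all $t\ge 0$, $$y_2(t)+|v(t)-e^\nu|+|v'(t)|\le Ce^{-\nu t}\qquad\text{and}\qquad |p_1(t)-(\mu-\nu)|\le Ce^{-\nu t}.$$ (ii) If $\nu\ge 1$, there are constants $C,K>0$ depending only on $\mu$ such that for every classical solution $\mathbf p$ whose initial value $\mathbf p(0)$ has mean $\mu$, the function $v$ is differentiable on $[0,\infty)$ (one-sidedly at $t=0$) and, for all $t\ge 0$, $$y_2(t)+|v(t)-e^\nu|+|v'(t)|\le C\langle t\rangle^{K}e^{-t}\qquad\text{and}\qquad |p_1(t)-(\mu-\nu)|\le C\langle t\rangle^{K}e^{-t}.$$ -/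

import Mathlib

namespace Dispersion

noncomputable section

/-- The space `ℓ^∞` of bounded real sequences indexed by `ℕ`. -/
abbrev EllInfty : Type := lp (fun _ : ℕ => ℝ) ⊤

/-- Probability distributions on `ℕ` with finite weighted norm `∑ (1 + n) |q n|`,
that is, with finite mean. -/
structure IsState (q : ℕ → ℝ) : Prop where
  mem_Icc : ∀ n, q n ∈ Set.Icc (0 : ℝ) 1
  hasSum_one : HasSum q 1
  summable_mean : Summable fun n : ℕ => (n : ℝ) * q n

/-- The mean `∑ n q n`. -/
def mean (q : ℕ → ℝ) : ℝ := ∑' n : ℕ, (n : ℝ) * q n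

/-- The active mass `∑_{n ≥ 2} n q n`. -/
def activeMass (q : ℕ → ℝ) : ℝ := ∑' n : ℕ, if 2 ≤ n then (n : ℝ) * q n else 0

/-- The generator of the mean-field dispersion dynamics, in components. -/
def generator (q : ℕ → ℝ) : ℕ → ℝ
  | 0 => -(activeMass q) * q 0
  | 1 => 2 * q 2 - activeMass q * (q 1 - q 0)
  | (n + 2) => ((n : ℝ) + 3) * q (n + 3) - ((n : ℝ) + 2) * q (n + 2)
      - activeMass q * (q (n + 2) - q (n + 1))

/-- The distance between two sequences in the weighted norm `∑ (1 + n) |q n|`. -/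
def weightedDist (q r : ℕ → ℝ) : ℝ := ∑' n : ℕ, (1 + (n : ℝ)) * |q n - r n|

/-- Classical solutions on `[0, ∞)`: curves of states that are continuous for the weighted norm,
continuously differentiable with values in `ℓ^∞`, and satisfy `p' = generator p`.
Derivatives are one-sided at `0`, and the values at negative times play no role. -/
structure IsClassicalSolution (p : ℝ → EllInfty) : Prop where
  state : ∀ t, 0 ≤ t → IsState (p t)
  continuous_weighted : ∀ t, 0 ≤ t →
    Filter.Tendsto (fun s => weightedDist (p s) (p t)) (nhdsWithin t (Set.Ici 0)) (nhds 0)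
  contDiffOn : ContDiffOn ℝ 1 p (Set.Ici 0)
  equation : ∀ t, 0 ≤ t → ∀ n, (derivWithin p (Set.Ici 0) t) n = generator (p t) n

/-- The principal branch of the Lambert function: for `x ≥ -e⁻¹`, the unique `y ≥ -1` with
`y e^y = x` (see `lambertW0_eq_iff`). -/
def lambertW0 (x : ℝ) : ℝ := Function.invFunOn (fun y : ℝ => y * Real.exp y) (Set.Ici (-1)) x

theorem lambertW0_eq_iff {x : ℝ} (hx : -Real.exp (-1) ≤ x) (y : ℝ) :
    lambertW0 x = y ↔ -1 ≤ y ∧ y * Real.exp y = x := by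
  have hex : ∃ z ∈ Set.Ici (-1 : ℝ), z * Real.exp z = x := by
    have hb : -1 ≤ max x 0 := le_trans (by norm_num) (le_max_right x 0)
    have hc : ContinuousOn (fun z : ℝ => z * Real.exp z) (Set.Icc (-1) (max x 0)) := by fun_prop
    have h1 : max x 0 ≤ max x 0 * Real.exp (max x 0) :=
      le_mul_of_one_le_right (le_max_right x 0) (Real.one_le_exp (le_max_right x 0))
    obtain ⟨z, hz, hzx⟩ := intermediate_value_Icc hb hc
      (show x ∈ Set.Icc _ _ from ⟨by simpa using hx, le_trans (le_max_left x 0) h1⟩)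
    exact ⟨z, hz.1, hzx⟩
  have hmono : StrictMonoOn (fun z : ℝ => z * Real.exp z) (Set.Ici (-1)) := by
    refine strictMonoOn_of_deriv_pos (convex_Ici _) (by fun_prop) fun z hz => ?_
    rw [interior_Ici] at hz
    have hd : HasDerivAt (fun z : ℝ => z * Real.exp z) (1 * Real.exp z + z * Real.exp z) z :=
      (hasDerivAt_id z).mul (Real.hasDerivAt_exp z)
    rw [hd.deriv]
    have hz' : 0 < 1 + z := by linarith [Set.mem_Ioi.mp hz]
    nlinarith [mul_pos hz' (Real.exp_pos z)]
  have hmem : lambertW0 x ∈ Set.Ici (-1 : ℝ) := Function.invFunOn_mem hex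
  have heq : lambertW0 x * Real.exp (lambertW0 x) = x := Function.invFunOn_eq hex
  constructor
  · rintro rfl
    exact ⟨hmem, heq⟩
  · rintro ⟨hy, hyx⟩
    exact hmono.injOn hmem hy (heq.trans hyx.symm)

/-- `ν = μ + W₀(-μ e^{-μ})`. -/
def nu (μ : ℝ) : ℝ := μ + lambertW0 (-μ * Real.exp (-μ))

/-- The auxiliary function `v(t) = exp (∫₀ᵗ e^{-t+s} a(s) ds)`, with `a` the active mass. -/
def auxV (p : ℝ → EllInfty) (t : ℝ) : ℝ :=
  Real.exp (∫ s in (0 : ℝ)..t, Real.exp (-t + s) * activeMass (p s))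

/-- `y₂(t) = ∫₀ᵗ |v(s) - e^ν| e^{-2t+2s} ds`. -/
def y2 (μ : ℝ) (p : ℝ → EllInfty) (t : ℝ) : ℝ :=
  ∫ s in (0 : ℝ)..t, |auxV p s - Real.exp (nu μ)| * Real.exp (-2 * t + 2 * s)

/-- The Japanese bracket `⟨t⟩ = √(1 + t²)`. -/
def japaneseBracket (t : ℝ) : ℝ := Real.sqrt (1 + t ^ 2)

end

end Dispersion

namespace Dispersion

/-! ### Moments of a state and telescoping of the generator -/

section States

variable {q r : ℕ → ℝ}

/-! Write `L` for `auxLog`, so that `v = e^L` and `L' = a - L`. Conservation of the mean gives `a =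
μ - p₁`. Following the generating function along the characteristics `z(s) = 1 - w e^{s-t}` then
leads to the integral identity `genFun_identity`. At `w = 1` it reads `e^{L(t)} = μ ∫₀ᵗ e^{s-t}
exp(e^{s-t} L(s)) ds + ξ(t)`, where `ξ` consists of a remnant of the initial data of size at most `μ
e^{-t}` and of `p₀ v = p₀(0) exp(-∫₀ᵗ L)`. The constant `ν` solves the same equation without forcing
and with a history reaching back to `-∞`: this is `ν = μ (1 - e^{-ν})`, or the fact that
`kernelDensity`, called `k` here, has mass one on `y ≤ 0`.

Convexity of the exponential makes `W = e^{|L-ν|} - 1` a subsolution of a linear Volterra equation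
with kernel `e^{s-t} k(s-t)` (`exp_abs_sub_one_le`). Putting `W = e^{-t} h` removes the factor
`e^{s-t}` and leaves a renewal inequality with a probability kernel. The supersolutions `h = e^{δt}`
and `h = 1 + t` yield the decay `e^{-(1-δ)t}`, or `(1 + t) e^{-t}` when the forcing is itself of
order `e^{-t}`.

The rate of `exp(-∫₀ᵗ L)` is found by a bootstrap (`exists_exp_neg_integral_auxLog_le`). The crude
bound `L ≥ (μ-1)(1 - e^{-t})` gives some exponential decay of `L - ν`, hence integrability, hence
the sharp rate `e^{-νt}`. The forcing is then of order `e^{-νt} + e^{-t}`, and the two regimes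
follow. Differentiating the identity in `w` at `w = 1` brings out `p₁`, which inherits the rate of
`L - ν`; so do `v`, `v'` and `y₂`. -/

theorem IsState.nonneg (hq : IsState q) (n : ℕ) : 0 ≤ q n := (hq.mem_Icc n).1

theorem IsState.le_one (hq : IsState q) (n : ℕ) : q n ≤ 1 := (hq.mem_Icc n).2

theorem IsState.hasSum_mean (hq : IsState q) : HasSum (fun n : ℕ => (n : ℝ) * q n) (mean q) :=
  hq.summable_mean.hasSum

theorem IsState.mul_le_mean (hq : IsState q) (n : ℕ) : (n : ℝ) * q n ≤ mean q :=
  le_hasSum hq.hasSum_mean n fun j _ => mul_nonneg j.cast_nonneg (hq.nonneg j)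

theorem IsState.hasSum_activeMass (hq : IsState q) :
    HasSum (fun n : ℕ => if 2 ≤ n then (n : ℝ) * q n else 0) (mean q - q 1) := by
  have h := hq.hasSum_mean.sub (hasSum_ite_eq (1 : ℕ) (q 1))
  refine h.congr_fun fun n => ?_
  rcases n with _ | _ | n <;> simp

theorem IsState.activeMass_eq (hq : IsState q) : activeMass q = mean q - q 1 :=
  hq.hasSum_activeMass.tsum_eq

theorem IsState.activeMass_nonneg (hq : IsState q) : 0 ≤ activeMass q := by
  rw [hq.activeMass_eq]
  have := hq.mul_le_mean 1
  simp at this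
  linarith

/-- The partial sums `∑_{n ≤ N} generator q n` telescope. -/
theorem sum_generator (q : ℕ → ℝ) (N : ℕ) :
    ∑ n ∈ Finset.range (N + 1), generator q n
      = (if 1 ≤ N then ((N : ℝ) + 1) * q (N + 1) else 0) - activeMass q * q N := by
  induction N with
  | zero => simp [generator]
  | succ N ih =>
    rw [Finset.sum_range_succ, ih]
    rcases N with _ | N
    · simp [generator]; ring
    · simp [generator]; ring

/-- Summation by parts behind the formula expressing the mean as the sum of the tail probabilities.
Tails suit conservation of the mean because the generator telescopes on partial sums. -/
theorem sum_tails (q : ℕ → ℝ) (K : ℕ) :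
    ∑ N ∈ Finset.range K, (1 - ∑ n ∈ Finset.range (N + 1), q n)
      = ∑ n ∈ Finset.range K, (n : ℝ) * q n + K * (1 - ∑ n ∈ Finset.range K, q n) := by
  induction K with
  | zero => simp
  | succ K ih =>
    rw [Finset.sum_range_succ, ih, Finset.sum_range_succ, Finset.sum_range_succ]
    push_cast
    ring

theorem IsState.tendsto_sum_tails (hq : IsState q) :
    Filter.Tendsto
      (fun K : ℕ => ∑ N ∈ Finset.range K, (1 - ∑ n ∈ Finset.range (N + 1), q n))
      Filter.atTop (nhds (mean q)) := by
  simp_rw [sum_tails]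
  have h1 := hq.hasSum_mean.tendsto_sum_nat
  have h2 : Filter.Tendsto (fun K : ℕ => (K : ℝ) * (1 - ∑ n ∈ Finset.range K, q n))
      Filter.atTop (nhds 0) := by
    refine squeeze_zero (g := fun K : ℕ => mean q - ∑ n ∈ Finset.range K, (n : ℝ) * q n)
      (fun K => ?_) (fun K => ?_) ?_
    · have := sum_le_hasSum (Finset.range K) (fun n _ => hq.nonneg n) hq.hasSum_one
      exact mul_nonneg K.cast_nonneg (by linarith)
    -- The boundary term is `K` times the tail mass beyond `K`, hence at most the tail of the first
    -- moment.
    · have e2 := hq.summable_mean.sum_add_tsum_nat_add K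
      have s1 := (summable_nat_add_iff K).2 hq.hasSum_one.summable
      have s2 := (summable_nat_add_iff K).2 hq.summable_mean
      have e1' := hq.hasSum_one.summable.sum_add_tsum_nat_add K
      rw [hq.hasSum_one.tsum_eq] at e1'
      have e3 : 1 - ∑ n ∈ Finset.range K, q n = ∑' i, q (i + K) := by linarith
      have e4 : mean q - ∑ n ∈ Finset.range K, (n : ℝ) * q n
          = ∑' i : ℕ, ((i + K : ℕ) : ℝ) * q (i + K) := by
        rw [mean]; linarith
      rw [e3, e4, ← tsum_mul_left]
      refine (s1.mul_left _).tsum_le_tsum (fun i => ?_) s2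
      exact mul_le_mul_of_nonneg_right (by push_cast; linarith [i.cast_nonneg (α := ℝ)])
        (hq.nonneg _)
    · simpa using h1.const_sub (mean q)
  simpa using h1.add h2

/-- Gain and loss both sum to the active mass: the gain is the series of `n qₙ` over `n ≥ 2`, the
loss is `activeMass q` times the total mass one. -/
theorem IsState.tendsto_sum_tails_flux (hq : IsState q) :
    Filter.Tendsto
      (fun K : ℕ => ∑ N ∈ Finset.range K, ∑ n ∈ Finset.range (N + 1), generator q n)
      Filter.atTop (nhds 0) := by
  simp_rw [sum_generator]
  have h1 := hq.hasSum_activeMass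
  rw [← hq.activeMass_eq, ← hasSum_nat_add_iff' 1] at h1
  have h2 := h1.sub (hq.hasSum_one.mul_left (activeMass q))
  simp only [Finset.range_one, Finset.sum_singleton] at h2
  have h3 := h2.tendsto_sum_nat
  simpa using h3

theorem IsState.abs_sum_tails_flux_le (hq : IsState q) (K : ℕ) :
    |∑ N ∈ Finset.range K, ∑ n ∈ Finset.range (N + 1), generator q n| ≤ activeMass q := by
  simp_rw [sum_generator]
  have h1 := hq.hasSum_activeMass
  rw [← hq.activeMass_eq, ← hasSum_nat_add_iff' 1] at h1
  have h2 := hq.hasSum_one.mul_left (activeMass q)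
  have ha := hq.activeMass_nonneg
  have b1 := sum_le_hasSum (Finset.range K) (fun n _ => by
    have := hq.nonneg (n + 1)
    positivity) h1
  have b2 := sum_le_hasSum (Finset.range K) (fun n _ => mul_nonneg ha (hq.nonneg n)) h2
  have c1 : 0 ≤ ∑ N ∈ Finset.range K, (if 1 ≤ N then ((N : ℝ) + 1) * q (N + 1) else 0) :=
    Finset.sum_nonneg fun n _ => by
      have := hq.nonneg (n + 1)
      positivity
  have c2 : 0 ≤ ∑ N ∈ Finset.range K, activeMass q * q N :=
    Finset.sum_nonneg fun n _ => mul_nonneg ha (hq.nonneg n)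
  rw [Finset.sum_sub_distrib, abs_le]
  simp at b1 b2 c1 c2 ⊢
  constructor <;> linarith

theorem abs_mean_sub_le (hq : IsState q) (hr : IsState r) :
    |mean q - mean r| ≤ weightedDist q r := by
  have h := hq.hasSum_mean.sub hr.hasSum_mean
  have hs : Summable fun n : ℕ => (1 + (n : ℝ)) * |q n - r n| := by
    refine Summable.of_nonneg_of_le (fun n => by positivity) (fun n => ?_)
      ((hq.hasSum_one.summable.add hq.summable_mean).add
        (hr.hasSum_one.summable.add hr.summable_mean))
    have : |q n - r n| ≤ q n + r n := by
      rw [abs_le]; constructor <;> linarith [hq.nonneg n, hr.nonneg n]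
    nlinarith [n.cast_nonneg (α := ℝ)]
  rw [← h.tsum_eq, ← Real.norm_eq_abs]
  refine tsum_of_norm_bounded hs.hasSum fun n => ?_
  rw [← mul_sub, norm_mul, Real.norm_eq_abs, Real.norm_eq_abs, Nat.abs_cast]
  exact mul_le_mul_of_nonneg_right (by linarith) (abs_nonneg _)

end States

/-! ### Regularity of solutions and conservation of the mean -/

section Solutions

variable {p : ℝ → EllInfty}

theorem IsClassicalSolution.hasDerivWithinAt_coord (hp : IsClassicalSolution p) {t : ℝ}
    (ht : 0 ≤ t) (n : ℕ) :
    HasDerivWithinAt (fun s => p s n) (generator (p t) n) (Set.Ici 0) t := by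
  have h := ((hp.contDiffOn.differentiableOn one_ne_zero) t ht).hasDerivWithinAt
  have h2 := (lp.evalCLM ℝ (fun _ : ℕ => ℝ) ⊤ n).hasFDerivAt.comp_hasDerivWithinAt t h
  rw [← hp.equation t ht n]
  exact h2

theorem IsClassicalSolution.continuousOn_coord (hp : IsClassicalSolution p) (n : ℕ) :
    ContinuousOn (fun s => p s n) (Set.Ici 0) :=
  fun _ ht => (hp.hasDerivWithinAt_coord ht n).continuousWithinAt

theorem IsClassicalSolution.hasDerivAt_coord (hp : IsClassicalSolution p) {t : ℝ}
    (ht : 0 < t) (n : ℕ) :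
    HasDerivAt (fun s => p s n) (generator (p t) n) t :=
  (hp.hasDerivWithinAt_coord ht.le n).hasDerivAt (Ici_mem_nhds ht)

theorem IsClassicalSolution.continuousOn_mean (hp : IsClassicalSolution p) :
    ContinuousOn (fun s => mean (p s)) (Set.Ici 0) := by
  intro t ht
  rw [ContinuousWithinAt, tendsto_iff_norm_sub_tendsto_zero]
  refine squeeze_zero' (Filter.Eventually.of_forall fun _ => norm_nonneg _) ?_
    (hp.continuous_weighted t ht)
  filter_upwards [self_mem_nhdsWithin] with s hs
  exact abs_mean_sub_le (hp.state s hs) (hp.state t ht)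

theorem IsClassicalSolution.continuousOn_activeMass (hp : IsClassicalSolution p) :
    ContinuousOn (fun s => activeMass (p s)) (Set.Ici 0) :=
  (hp.continuousOn_mean.sub (hp.continuousOn_coord 1)).congr fun t ht =>
    (hp.state t ht).activeMass_eq

theorem IsClassicalSolution.continuousOn_generator (hp : IsClassicalSolution p) (n : ℕ) :
    ContinuousOn (fun s => generator (p s) n) (Set.Ici 0) := by
  have ha := hp.continuousOn_activeMass
  have hc := hp.continuousOn_coord
  rcases n with _ | _ | n
  · exact ha.neg.mul (hc 0)
  · exact (continuousOn_const.mul (hc 2)).sub (ha.mul ((hc 1).sub (hc 0)))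
  · exact ((continuousOn_const.mul (hc (n + 3))).sub (continuousOn_const.mul (hc (n + 2)))).sub
      (ha.mul ((hc (n + 2)).sub (hc (n + 1))))

/-- The mean is conserved. -/
theorem IsClassicalSolution.mean_eq (hp : IsClassicalSolution p) {t : ℝ} (ht : 0 ≤ t) :
    mean (p t) = mean (p 0) := by
  have hsub : Set.uIcc 0 t ⊆ Set.Ici 0 := by
    rw [Set.uIcc_of_le ht]; exact Set.Icc_subset_Ici_self
  have hcont (K : ℕ) : ContinuousOn (fun s => ∑ N ∈ Finset.range K,
      ∑ n ∈ Finset.range (N + 1), generator (p s) n) (Set.Ici 0) :=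
    continuousOn_finsetSum _ fun N _ => continuousOn_finsetSum _ fun n _ =>
      hp.continuousOn_generator n
  have hint (K : ℕ) : ∫ s in (0 : ℝ)..t, (∑ N ∈ Finset.range K,
      ∑ n ∈ Finset.range (N + 1), generator (p s) n)
      = ∑ N ∈ Finset.range K, (1 - ∑ n ∈ Finset.range (N + 1), p 0 n)
        - ∑ N ∈ Finset.range K, (1 - ∑ n ∈ Finset.range (N + 1), p t n) := by
    rw [intervalIntegral.integral_eq_sub_of_hasDerivAt_of_le ht
      (f := fun s => ∑ N ∈ Finset.range K, ∑ n ∈ Finset.range (N + 1), p s n)]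
    · simp only [Finset.sum_sub_distrib]; ring
    · exact (continuousOn_finsetSum _ fun N _ => continuousOn_finsetSum _ fun n _ =>
        hp.continuousOn_coord n).mono Set.Icc_subset_Ici_self
    · intro s hs
      exact HasDerivAt.fun_sum fun N _ => HasDerivAt.fun_sum fun n _ => hp.hasDerivAt_coord hs.1 n
    · exact ((hcont K).mono hsub).intervalIntegrable
  -- The time derivative of the mean cannot be taken termwise. The truncated tail sums are
  -- integrated in time first, and their flux tends to zero while dominated by the active mass.
  have hlim := intervalIntegral.tendsto_integral_filter_of_dominated_convergence
    (μ := MeasureTheory.volume) (a := 0) (b := t) (l := Filter.atTop)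
    (F := fun (K : ℕ) s => ∑ N ∈ Finset.range K, ∑ n ∈ Finset.range (N + 1), generator (p s) n)
    (f := fun _ => (0 : ℝ)) (fun s => activeMass (p s))
    (Filter.Eventually.of_forall fun K =>
      ((hcont K).mono (Set.uIoc_subset_uIcc.trans hsub)).aestronglyMeasurable measurableSet_uIoc)
    (Filter.Eventually.of_forall fun K => Filter.Eventually.of_forall fun s hs =>
      (hp.state s (hsub (Set.uIoc_subset_uIcc hs))).abs_sum_tails_flux_le K)
    (hp.continuousOn_activeMass.mono hsub).intervalIntegrable
    (Filter.Eventually.of_forall fun s hs =>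
      (hp.state s (hsub (Set.uIoc_subset_uIcc hs))).tendsto_sum_tails_flux)
  simp_rw [hint] at hlim
  have h2 := (hp.state 0 le_rfl).tendsto_sum_tails.sub (hp.state t ht).tendsto_sum_tails
  have := tendsto_nhds_unique hlim h2
  simp at this
  linarith

end Solutions

/-! ### Calculus of the discounted memory -/

section Lag

/-- The exponentially discounted memory `∫₀ᵗ e^{-t+s} a(s) ds`. -/
noncomputable def lag (a : ℝ → ℝ) (t : ℝ) : ℝ := ∫ s in (0 : ℝ)..t, Real.exp (-t + s) * a s

@[simp] theorem lag_zero (a : ℝ → ℝ) : lag a 0 = 0 := by simp [lag]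

/-- Nothing is known about `f` at negative times, so it is replaced by the continuous extension `f
(max s 0)`, to which the two-sided fundamental theorem applies. -/
theorem hasDerivWithinAt_integral_Ici {f : ℝ → ℝ} (hf : ContinuousOn f (Set.Ici 0)) {t : ℝ}
    (ht : 0 ≤ t) :
    HasDerivWithinAt (fun u => ∫ s in (0 : ℝ)..u, f s) (f t) (Set.Ici 0) t := by
  have hc : Continuous fun s : ℝ => f (max s 0) :=
    hf.comp_continuous (by fun_prop) fun s => le_max_right s 0
  have heq : ∀ u ∈ Set.Ici (0 : ℝ),
      ∫ s in (0 : ℝ)..u, f s = ∫ s in (0 : ℝ)..u, f (max s 0) := by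
    intro u hu
    refine intervalIntegral.integral_congr fun s hs => ?_
    rw [Set.uIcc_of_le hu] at hs
    simp only [max_eq_left hs.1]
  have h1 : HasDerivAt (fun u => ∫ s in (0 : ℝ)..u, f (max s 0)) (f (max t 0)) t :=
    intervalIntegral.integral_hasDerivAt_right (hc.intervalIntegrable _ _)
      hc.stronglyMeasurable.stronglyMeasurableAtFilter hc.continuousAt
  rw [max_eq_left ht] at h1
  exact h1.hasDerivWithinAt.congr heq (heq t ht)

theorem hasDerivWithinAt_lag {a : ℝ → ℝ} (ha : ContinuousOn a (Set.Ici 0)) {t : ℝ} (ht : 0 ≤ t) :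
    HasDerivWithinAt (lag a) (a t - lag a t) (Set.Ici 0) t := by
  have heq : lag a = fun u => Real.exp (-u) * ∫ s in (0 : ℝ)..u, Real.exp s * a s := by
    funext u
    simp only [lag, ← intervalIntegral.integral_const_mul, Real.exp_add, mul_assoc]
  have h1 := hasDerivWithinAt_integral_Ici (Real.continuous_exp.continuousOn.mul ha) ht
  rw [heq]
  refine ((hasDerivAt_neg t).exp.hasDerivWithinAt.mul h1).congr_deriv ?_
  have : Real.exp (-t) * (Real.exp t * a t) = a t := by
    rw [← mul_assoc, ← Real.exp_add]; simp
  simp only [Pi.mul_apply]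
  rw [this]
  ring

theorem continuousOn_lag {a : ℝ → ℝ} (ha : ContinuousOn a (Set.Ici 0)) :
    ContinuousOn (lag a) (Set.Ici 0) :=
  fun _ ht => (hasDerivWithinAt_lag ha ht).continuousWithinAt

theorem integral_exp_neg_add (t : ℝ) :
    ∫ s in (0 : ℝ)..t, Real.exp (-t + s) = 1 - Real.exp (-t) := by
  rw [intervalIntegral.integral_eq_sub_of_hasDerivAt (f := fun s => Real.exp (-t + s))]
  · simp
  · intro s _
    simpa using ((hasDerivAt_id s).const_add (-t)).exp
  · exact (by fun_prop : Continuous fun s : ℝ => Real.exp (-t + s)).intervalIntegrable _ _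

theorem mul_le_lag {a : ℝ → ℝ} (ha : ContinuousOn a (Set.Ici 0)) {c : ℝ}
    (hc : ∀ s, 0 ≤ s → c ≤ a s) {t : ℝ} (ht : 0 ≤ t) :
    c * (1 - Real.exp (-t)) ≤ lag a t := by
  rw [← integral_exp_neg_add, mul_comm, ← intervalIntegral.integral_mul_const]
  have hsub : Set.uIcc 0 t ⊆ Set.Ici 0 := by
    rw [Set.uIcc_of_le ht]; exact Set.Icc_subset_Ici_self
  refine intervalIntegral.integral_mono_on ht
    (Continuous.intervalIntegrable (by fun_prop) _ _)
    ((ContinuousOn.mul (by fun_prop) (ha.mono hsub)).intervalIntegrable) fun s hs => ?_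
  exact mul_le_mul_of_nonneg_left (hc s hs.1) (Real.exp_pos _).le

theorem lag_le_mul {a : ℝ → ℝ} (ha : ContinuousOn a (Set.Ici 0)) {c : ℝ}
    (hc : ∀ s, 0 ≤ s → a s ≤ c) {t : ℝ} (ht : 0 ≤ t) :
    lag a t ≤ c * (1 - Real.exp (-t)) := by
  rw [← integral_exp_neg_add, mul_comm, ← intervalIntegral.integral_mul_const]
  have hsub : Set.uIcc 0 t ⊆ Set.Ici 0 := by
    rw [Set.uIcc_of_le ht]; exact Set.Icc_subset_Ici_self
  refine intervalIntegral.integral_mono_on ht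
    ((ContinuousOn.mul (by fun_prop) (ha.mono hsub)).intervalIntegrable)
    (Continuous.intervalIntegrable (by fun_prop) _ _) fun s hs => ?_
  exact mul_le_mul_of_nonneg_left (hc s hs.1) (Real.exp_pos _).le

end Lag

/-! ### Generating functions of states -/

section GeneratingFunction

/-- The probability generating function `∑ qₙ zⁿ`. -/
noncomputable def genFun (q : ℕ → ℝ) (z : ℝ) : ℝ := ∑' n : ℕ, q n * z ^ n

/-- The derivative `∑ n qₙ zⁿ⁻¹` of the probability generating function. -/
noncomputable def genFunDeriv (q : ℕ → ℝ) (z : ℝ) : ℝ := ∑' n : ℕ, q n * (n * z ^ (n - 1))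

theorem summable_mul_pow_pred {r : ℝ} (h0 : 0 ≤ r) (h1 : r < 1) :
    Summable fun n : ℕ => (n : ℝ) * r ^ (n - 1) := by
  rw [← summable_nat_add_iff 1]
  have h := (summable_pow_mul_geometric_of_norm_lt_one 1
    (by rwa [Real.norm_of_nonneg h0] : ‖r‖ < 1)).add (summable_geometric_of_lt_one h0 h1)
  refine h.congr fun n => ?_
  simp
  ring

variable {q : ℕ → ℝ}

theorem IsState.norm_mul_pow_le (hq : IsState q) {z r : ℝ} (hz : |z| ≤ r) (n : ℕ) :
    ‖q n * z ^ n‖ ≤ r ^ n := by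
  rw [norm_mul, norm_pow, Real.norm_of_nonneg (hq.nonneg n), Real.norm_eq_abs]
  calc q n * |z| ^ n ≤ 1 * r ^ n := by gcongr; exact hq.le_one n
    _ = r ^ n := one_mul _

theorem IsState.norm_mul_mul_pow_le (hq : IsState q) {z r : ℝ} (hz : |z| ≤ r) (n : ℕ) :
    ‖q n * (n * z ^ (n - 1))‖ ≤ n * r ^ (n - 1) := by
  rw [norm_mul, norm_mul, norm_pow, Real.norm_of_nonneg (hq.nonneg n), Real.norm_eq_abs z,
    Real.norm_of_nonneg n.cast_nonneg]
  calc q n * (n * |z| ^ (n - 1)) ≤ 1 * (n * r ^ (n - 1)) := by gcongr; exact hq.le_one n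
    _ = _ := one_mul _

theorem IsState.hasSum_genFun (hq : IsState q) {z : ℝ} (hz : |z| < 1) :
    HasSum (fun n => q n * z ^ n) (genFun q z) :=
  (Summable.of_norm_bounded (summable_geometric_of_lt_one (abs_nonneg z) hz)
    (hq.norm_mul_pow_le le_rfl)).hasSum

theorem IsState.hasSum_genFunDeriv (hq : IsState q) {z : ℝ} (hz : |z| < 1) :
    HasSum (fun n : ℕ => q n * (n * z ^ (n - 1))) (genFunDeriv q z) :=
  (Summable.of_norm_bounded (summable_mul_pow_pred (abs_nonneg z) hz)
    (hq.norm_mul_mul_pow_le le_rfl)).hasSum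

theorem IsState.hasDerivAt_genFun (hq : IsState q) {z : ℝ} (hz : |z| < 1) :
    HasDerivAt (genFun q) (genFunDeriv q z) z := by
  obtain ⟨r, hzr, hr⟩ := exists_between hz
  have hr0 : 0 ≤ r := (abs_nonneg z).trans hzr.le
  refine hasDerivAt_tsum_of_isPreconnected (t := Set.Ioo (-r) r) (y₀ := z)
    (summable_mul_pow_pred hr0 hr) isOpen_Ioo isPreconnected_Ioo (fun n y _ => ?_)
    (fun n y hy => hq.norm_mul_mul_pow_le (abs_lt.2 hy).le n) (abs_lt.1 hzr)
    (hq.hasSum_genFun hz).summable (abs_lt.1 hzr)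
  exact (hasDerivAt_pow n y).const_mul _

theorem genFun_at_zero (q : ℕ → ℝ) : genFun q 0 = q 0 := by
  rw [genFun, tsum_eq_single 0 (fun n hn => by simp [hn])]
  simp

theorem genFunDeriv_at_zero (q : ℕ → ℝ) : genFunDeriv q 0 = q 1 := by
  rw [genFunDeriv, tsum_eq_single 1 (fun n hn => ?_)]
  · simp
  · rcases n with _ | _ | n
    · simp
    · simp at hn
    · simp

theorem IsState.abs_genFunDeriv_le (hq : IsState q) {z : ℝ} (hz : |z| ≤ 1) :
    |genFunDeriv q z| ≤ mean q := by
  rw [← Real.norm_eq_abs]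
  refine tsum_of_norm_bounded hq.hasSum_mean fun n => ?_
  rw [norm_mul, norm_mul, norm_pow, Real.norm_of_nonneg (hq.nonneg n), Real.norm_eq_abs z,
    Real.norm_of_nonneg n.cast_nonneg]
  have h1 : |z| ^ (n - 1) ≤ 1 := pow_le_one₀ (abs_nonneg z) hz
  have h2 := mul_nonneg n.cast_nonneg (hq.nonneg n)
  nlinarith

/-- The upper bound is Bernoulli's inequality, term by term. With `x = e^{-t}` it shows that the
initial data are forgotten at rate `e^{-t}`, uniformly among states of given mean. -/
theorem IsState.one_sub_genFun_mem (hq : IsState q) {x : ℝ} (h0 : 0 < x) (h1 : x ≤ 1) :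
    1 - genFun q (1 - x) ∈ Set.Icc 0 (mean q * x) := by
  have hz : |1 - x| < 1 := by rw [abs_lt]; constructor <;> linarith
  have h := hq.hasSum_one.sub (hq.hasSum_genFun hz)
  constructor
  · refine h.nonneg fun n => ?_
    have : (1 - x) ^ n ≤ 1 := pow_le_one₀ (by linarith) (by linarith)
    nlinarith [hq.nonneg n]
  · refine hasSum_le (fun n => ?_) h (hq.hasSum_mean.mul_right x)
    have := one_add_mul_le_pow (by linarith : (-2 : ℝ) ≤ -x) n
    rw [← sub_eq_add_neg] at this
    nlinarith [hq.nonneg n]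

/-- The action of the generator on the generating function. -/
theorem IsState.hasSum_generator_mul_pow (hq : IsState q) {z : ℝ} (hz : |z| < 1) :
    HasSum (fun n => generator q n * z ^ n)
      ((1 - z) * (genFunDeriv q z - q 1 - activeMass q * genFun q z)) := by
  have hG := hq.hasSum_genFun hz
  have hD := hq.hasSum_genFunDeriv hz
  have hD1 : HasSum (fun n : ℕ => ((n : ℝ) + 1) * q (n + 1) * z ^ n) (genFunDeriv q z) := by
    have := (hasSum_nat_add_iff' 1).2 hD
    simp only [Finset.range_one, Finset.sum_singleton, Nat.cast_zero, zero_mul, mul_zero,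
      sub_zero] at this
    refine this.congr_fun fun n => ?_
    simp
    ring
  have hS : HasSum (fun n : ℕ => if 1 ≤ n then q (n - 1) * z ^ n else 0) (z * genFun q z) := by
    rw [← hasSum_nat_add_iff' 1]
    simp only [Finset.range_one, Finset.sum_singleton]
    have := hG.mul_left z
    simp only [nonpos_iff_eq_zero, one_ne_zero, if_false, sub_zero]
    refine this.congr_fun fun n => ?_
    simp [pow_succ]
    ring
  -- The formula for `n ≥ 2`, extended to all `n`, would let single particles jump; it is wrong by
  -- `q 1` at `n = 0` and by `-q 1` at `n = 1`. The last two series correct this.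
  have h := (((hD1.sub (hD.mul_left z)).sub ((hG.sub hS).mul_left (activeMass q))).sub
    (hasSum_ite_eq (0 : ℕ) (q 1))).add (hasSum_ite_eq (1 : ℕ) (q 1 * z))
  have e : (1 - z) * (genFunDeriv q z - q 1 - activeMass q * genFun q z)
      = genFunDeriv q z - z * genFunDeriv q z
        - activeMass q * (genFun q z - z * genFun q z) - q 1 + q 1 * z := by ring
  rw [e]
  refine h.congr_fun fun n => ?_
  rcases n with _ | _ | n
  · simp [generator]
  · simp [generator]; ring
  · simp [generator, pow_succ]; ring

/-- Together with conservation of the mean, this bound, uniform in `n` and in time, allows termwise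
differentiation of the generating function. -/
theorem IsState.abs_generator_le (hq : IsState q) (n : ℕ) : |generator q n| ≤ 3 * mean q := by
  have ha := hq.activeMass_nonneg
  have hae := hq.activeMass_eq
  have h1 := hq.nonneg 1
  have ham : activeMass q ≤ mean q := by linarith
  have hm : 0 ≤ mean q := ha.trans ham
  rcases n with _ | _ | n
  · have h0 := hq.nonneg 0
    have h0' := hq.le_one 0
    rw [generator, abs_le]
    constructor <;> nlinarith
  · have h0 := hq.nonneg 0
    have h0' := hq.le_one 0
    have h1' := hq.le_one 1
    have h2 := hq.nonneg 2
    have h2' := hq.mul_le_mean 2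
    rw [generator, abs_le]
    push_cast at h2'
    constructor <;> nlinarith
  · have h0 := hq.nonneg (n + 1)
    have h0' := hq.le_one (n + 1)
    have h1 := hq.nonneg (n + 2)
    have h1' := hq.le_one (n + 2)
    have h2 := hq.mul_le_mean (n + 2)
    have h2' := hq.mul_le_mean (n + 3)
    have h3 := hq.nonneg (n + 3)
    have e2 : 0 ≤ ((n : ℝ) + 2) * q (n + 2) := by positivity
    have e3 : 0 ≤ ((n : ℝ) + 3) * q (n + 3) := by positivity
    push_cast at h2 h2'
    rw [generator, abs_le]
    constructor <;> nlinarith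

end GeneratingFunction

/-! ### The generating function along characteristics -/

section Characteristics

variable {p : ℝ → EllInfty}

/-- The generating function along the characteristic `z(s) = 1 - w e^{s-t}`. -/
theorem IsClassicalSolution.hasDerivAt_genFun_char (hp : IsClassicalSolution p) {t w r : ℝ}
    (hr0 : 0 ≤ r) (hr : r < 1) (hz : ∀ s ∈ Set.Icc 0 t, |1 - w * Real.exp (s - t)| ≤ r)
    {s : ℝ} (hs : s ∈ Set.Ioo 0 t) :
    HasDerivAt (fun s => genFun (p s) (1 - w * Real.exp (s - t)))
      (-(w * Real.exp (s - t))
        * (p s 1 + activeMass (p s) * genFun (p s) (1 - w * Real.exp (s - t)))) s := by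
  have hzd (y : ℝ) : HasDerivAt (fun s => 1 - w * Real.exp (s - t)) (-(w * Real.exp (y - t))) y := by
    simpa using ((((hasDerivAt_id y).sub_const t).exp).const_mul w).const_sub 1
  have hz' : ∀ y ∈ Set.Ioo 0 t, |w * Real.exp (y - t)| ≤ 2 := fun y hy => by
    have := hz y (Set.Ioo_subset_Icc_self hy)
    rw [abs_le] at this ⊢
    constructor <;> linarith
  have hu : Summable fun n : ℕ => 3 * mean (p 0) * r ^ n + 2 * (n * r ^ (n - 1)) :=
    ((summable_geometric_of_lt_one hr0 hr).mul_left _).add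
      ((summable_mul_pow_pred hr0 hr).mul_left _)
  have key := hasDerivAt_tsum_of_isPreconnected (t := Set.Ioo 0 t) (y₀ := s)
    (g := fun n s => p s n * (1 - w * Real.exp (s - t)) ^ n)
    (g' := fun n s => generator (p s) n * (1 - w * Real.exp (s - t)) ^ n
      + p s n * (n * (1 - w * Real.exp (s - t)) ^ (n - 1) * -(w * Real.exp (s - t))))
    hu isOpen_Ioo isPreconnected_Ioo
    (fun n y hy => (hp.hasDerivAt_coord hy.1 n).mul ((hzd y).pow n))
    (fun n y hy => ?_) hs ?_ hs
  · refine key.congr_deriv ?_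
    have hst := hp.state s hs.1.le
    -- Since `1 - z = w e^{s-t}` and `z' = -w e^{s-t}`, the terms with `genFunDeriv` cancel in the
    -- sum.
    have hz1 := (hz s (Set.Ioo_subset_Icc_self hs)).trans_lt hr
    have h1 := hst.hasSum_generator_mul_pow hz1
    have h2 := (hst.hasSum_genFunDeriv hz1).mul_right (-(w * Real.exp (s - t)))
    refine ((h1.add h2).congr_fun fun n => ?_).tsum_eq.trans ?_
    · ring
    · ring
  · have hst := hp.state y hy.1.le
    have hzy := hz y (Set.Ioo_subset_Icc_self hy)
    refine (norm_add_le _ _).trans (add_le_add ?_ ?_)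
    · rw [norm_mul, norm_pow, Real.norm_eq_abs, Real.norm_eq_abs]
      have := hst.abs_generator_le n
      rw [hp.mean_eq hy.1.le] at this
      gcongr
      exact (abs_nonneg _).trans this
    · rw [← mul_assoc, norm_mul, mul_comm]
      exact mul_le_mul (by simpa using hz' y hy) (hst.norm_mul_mul_pow_le hzy n)
        (norm_nonneg _) (by norm_num)
  · exact ((hp.state s hs.1.le).hasSum_genFun
      ((hz s (Set.Ioo_subset_Icc_self hs)).trans_lt hr)).summable

theorem IsClassicalSolution.continuousOn_genFun_char (hp : IsClassicalSolution p) {t w r : ℝ}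
    (hr0 : 0 ≤ r) (hr : r < 1) (hz : ∀ s ∈ Set.Icc 0 t, |1 - w * Real.exp (s - t)| ≤ r) :
    ContinuousOn (fun s => genFun (p s) (1 - w * Real.exp (s - t))) (Set.Icc 0 t) :=
  continuousOn_tsum
    (fun n => ((hp.continuousOn_coord n).mono Set.Icc_subset_Ici_self).mul
      (by fun_prop))
    (summable_geometric_of_lt_one hr0 hr)
    (fun n s hs => (hp.state s hs.1).norm_mul_pow_le (hz s hs) n)

/-- The closed integral equation satisfied by the generating function and the memory term. -/
theorem IsClassicalSolution.genFun_identity (hp : IsClassicalSolution p) {t w : ℝ}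
    (ht : 0 ≤ t) (hw : w ∈ Set.Ioo 0 2) :
    (1 - genFun (p t) (1 - w)) * Real.exp (w * lag (fun s => activeMass (p s)) t)
      = 1 - genFun (p 0) (1 - w * Real.exp (-t))
        + mean (p 0) * ∫ s in (0 : ℝ)..t, w * Real.exp (s - t)
            * Real.exp (w * Real.exp (s - t) * lag (fun s => activeMass (p s)) s) := by
  set L := lag (fun s => activeMass (p s)) with hL
  have hLd : ∀ s, 0 ≤ s → HasDerivWithinAt L (activeMass (p s) - L s) (Set.Ici 0) s :=
    fun s hs => hasDerivWithinAt_lag hp.continuousOn_activeMass hs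
  have hLc : ContinuousOn L (Set.Ici 0) := continuousOn_lag hp.continuousOn_activeMass
  obtain ⟨r, hr0, hr, hz⟩ : ∃ r : ℝ, 0 ≤ r ∧ r < 1 ∧
      ∀ s ∈ Set.Icc 0 t, |1 - w * Real.exp (s - t)| ≤ r := by
    have he := mul_pos hw.1 (Real.exp_pos (-t))
    -- The characteristic moves monotonically from `1 - w e^{-t}` to `1 - w`; with `0 < w < 2` both
    -- ends lie strictly inside the unit disc.
    refine ⟨max 0 (max (1 - w * Real.exp (-t)) (w - 1)), le_max_left _ _,
      max_lt one_pos (max_lt (by linarith) (by linarith [hw.2])), fun s hs => ?_⟩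
    refine (abs_le.2 ⟨?_, ?_⟩).trans (le_max_right _ _)
    · have h1 : Real.exp (s - t) ≤ 1 := Real.exp_le_one_iff.2 (by linarith [hs.2])
      have := le_max_right (1 - w * Real.exp (-t)) (w - 1)
      nlinarith [hw.1]
    · refine le_trans ?_ (le_max_left _ _)
      have h1 : Real.exp (-t) ≤ Real.exp (s - t) := Real.exp_le_exp.2 (by linarith [hs.1])
      nlinarith [hw.1]
  have hsub : Set.Icc 0 t ⊆ Set.Ici (0 : ℝ) := Set.Icc_subset_Ici_self
  -- The integrating factor works because `(e^{s-t} L)' = e^{s-t} a`: the terms `a * genFun` cancel,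
  -- and what remains is `p₁ + a`, the conserved mean.
  have key := intervalIntegral.integral_eq_sub_of_hasDerivAt_of_le ht
    (f := fun s => (1 - genFun (p s) (1 - w * Real.exp (s - t)))
      * Real.exp (w * Real.exp (s - t) * L s))
    (f' := fun s => mean (p 0) * (w * Real.exp (s - t) * Real.exp (w * Real.exp (s - t) * L s)))
    ?_ ?_ ?_
  · rw [intervalIntegral.integral_const_mul] at key
    rw [key]
    simp [hL]
  · exact (continuousOn_const.sub (hp.continuousOn_genFun_char hr0 hr hz)).mul
      (Real.continuous_exp.comp_continuousOn
        (ContinuousOn.mul (by fun_prop) (hLc.mono hsub)))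
  · intro s hs
    have h1 := hp.hasDerivAt_genFun_char hr0 hr hz hs
    have h2 : HasDerivAt (fun s => w * Real.exp (s - t)) (w * Real.exp (s - t)) s := by
      simpa using (((hasDerivAt_id s).sub_const t).exp).const_mul w
    have h3 := (hLd s hs.1.le).hasDerivAt (Ici_mem_nhds hs.1)
    refine ((h1.const_sub 1).mul (h2.mul h3).exp).congr_deriv ?_
    have h4 := (hp.state s hs.1.le).activeMass_eq
    rw [hp.mean_eq hs.1.le] at h4
    have h5 : mean (p 0) = activeMass (p s) + p s 1 := by linarith
    rw [h5]
    simp only [Pi.mul_apply]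
    ring
  · refine (ContinuousOn.intervalIntegrable ?_)
    rw [Set.uIcc_of_le ht]
    exact continuousOn_const.mul (ContinuousOn.mul (by fun_prop)
      (Real.continuous_exp.comp_continuousOn
        (ContinuousOn.mul (by fun_prop) (hLc.mono hsub))))

/-- The first-order form of `genFun_identity` at `w = 1`. -/
theorem IsClassicalSolution.genFunDeriv_identity (hp : IsClassicalSolution p) {t : ℝ}
    (ht : 0 ≤ t) :
    (p t 1 + (1 - p t 0) * lag (fun s => activeMass (p s)) t)
        * Real.exp (lag (fun s => activeMass (p s)) t)
      = genFunDeriv (p 0) (1 - Real.exp (-t)) * Real.exp (-t)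
        + mean (p 0) * ∫ s in (0 : ℝ)..t, Real.exp (s - t)
            * (1 + Real.exp (s - t) * lag (fun s => activeMass (p s)) s)
            * Real.exp (Real.exp (s - t) * lag (fun s => activeMass (p s)) s) := by
  set L := lag (fun s => activeMass (p s)) with hL
  have hLc : ContinuousOn L (Set.Icc 0 t) :=
    (continuousOn_lag hp.continuousOn_activeMass).mono Set.Icc_subset_Ici_self
  have hLc' : ContinuousOn L (Set.uIoc 0 t) :=
    hLc.mono (by rw [Set.uIoc_of_le ht]; exact Set.Ioc_subset_Icc_self)
  obtain ⟨B, hB⟩ := isCompact_Icc.exists_bound_of_continuousOn hLc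
  have hB0 : 0 ≤ B := (norm_nonneg _).trans (hB 0 ⟨le_rfl, ht⟩)
  have hleft : HasDerivAt (fun w => (1 - genFun (p t) (1 - w)) * Real.exp (w * L t))
      ((p t 1 + (1 - p t 0) * L t) * Real.exp (L t)) 1 := by
    have h1 : HasDerivAt (genFun (p t)) (genFunDeriv (p t) (1 - 1)) (1 - 1) :=
      (hp.state t ht).hasDerivAt_genFun (by simp)
    have h2 := (h1.comp 1 ((hasDerivAt_id (1 : ℝ)).const_sub 1)).const_sub 1
    refine (h2.mul ((hasDerivAt_id (1 : ℝ)).mul_const (L t)).exp).congr_deriv ?_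
    simp [genFun_at_zero, genFunDeriv_at_zero]
    ring
  have hright1 : HasDerivAt (fun w => 1 - genFun (p 0) (1 - w * Real.exp (-t)))
      (genFunDeriv (p 0) (1 - Real.exp (-t)) * Real.exp (-t)) 1 := by
    have hz : |1 - 1 * Real.exp (-t)| < 1 := by
      have := Real.exp_pos (-t)
      have : Real.exp (-t) ≤ 1 := Real.exp_le_one_iff.2 (by linarith)
      rw [abs_lt]; constructor <;> linarith
    have h1 := (hp.state 0 le_rfl).hasDerivAt_genFun hz
    have h2 := (h1.comp 1 (((hasDerivAt_id (1 : ℝ)).mul_const (Real.exp (-t))).const_sub 1))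
    refine (h2.const_sub 1).congr_deriv ?_
    simp
  have hright2 : HasDerivAt (fun w => ∫ s in (0 : ℝ)..t, w * Real.exp (s - t)
        * Real.exp (w * Real.exp (s - t) * L s))
      (∫ s in (0 : ℝ)..t, Real.exp (s - t) * (1 + Real.exp (s - t) * L s)
        * Real.exp (Real.exp (s - t) * L s)) 1 := by
    refine ((intervalIntegral.hasDerivAt_integral_of_dominated_loc_of_deriv_le
      (μ := MeasureTheory.volume) (s := Set.Ioo 0 2)
      (F := fun w s => w * Real.exp (s - t) * Real.exp (w * Real.exp (s - t) * L s))
      (F' := fun w s => Real.exp (s - t) * (1 + w * Real.exp (s - t) * L s)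
        * Real.exp (w * Real.exp (s - t) * L s))
      (bound := fun _ => (1 + 2 * B) * Real.exp (2 * B))
      (Ioo_mem_nhds (by norm_num) (by norm_num)) ?_ ?_ ?_ ?_ (by simp) ?_).2).congr_deriv ?_
    · refine Filter.Eventually.of_forall fun w => ?_
      exact ContinuousOn.aestronglyMeasurable (ContinuousOn.mul (by fun_prop)
        (Real.continuous_exp.comp_continuousOn
          (ContinuousOn.mul (by fun_prop) hLc'))) measurableSet_uIoc
    · refine ContinuousOn.intervalIntegrable ?_
      rw [Set.uIcc_of_le ht]
      exact ContinuousOn.mul (by fun_prop)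
        (Real.continuous_exp.comp_continuousOn (ContinuousOn.mul (by fun_prop) hLc))
    · refine ContinuousOn.aestronglyMeasurable ?_ measurableSet_uIoc
      exact (ContinuousOn.mul (by fun_prop)
        (continuousOn_const.add (ContinuousOn.mul (by fun_prop) hLc'))).mul
        (Real.continuous_exp.comp_continuousOn (ContinuousOn.mul (by fun_prop) hLc'))
    · refine Filter.Eventually.of_forall fun s hs w hw => ?_
      rw [Set.uIoc_of_le ht] at hs
      have hLs := hB s (Set.Ioc_subset_Icc_self hs)
      have he0 := Real.exp_pos (s - t)
      have he1 : Real.exp (s - t) ≤ 1 := Real.exp_le_one_iff.2 (by linarith [hs.2])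
      have hx : |w * Real.exp (s - t) * L s| ≤ 2 * B := by
        rw [abs_mul]
        refine mul_le_mul ?_ hLs (abs_nonneg _) (by norm_num)
        rw [abs_of_pos (mul_pos hw.1 he0)]
        nlinarith [hw.1, hw.2]
      rw [norm_mul, norm_mul, Real.norm_of_nonneg he0.le, Real.norm_of_nonneg (Real.exp_pos _).le]
      have h1 : ‖1 + w * Real.exp (s - t) * L s‖ ≤ 1 + 2 * B :=
        (norm_add_le _ _).trans (by simpa using hx)
      have h2 : Real.exp (w * Real.exp (s - t) * L s) ≤ Real.exp (2 * B) :=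
        Real.exp_le_exp.2 ((le_abs_self _).trans hx)
      refine mul_le_mul ?_ h2 (Real.exp_pos _).le (by positivity)
      calc _ ≤ 1 * (1 + 2 * B) := mul_le_mul he1 h1 (norm_nonneg _) zero_le_one
        _ = _ := one_mul _
    · refine Filter.Eventually.of_forall fun s _ w _ => ?_
      have h1 := (hasDerivAt_id w).mul_const (Real.exp (s - t))
      refine (h1.mul (h1.mul_const (L s)).exp).congr_deriv ?_
      simp
      ring
    · simp
  have hev : (fun w => (1 - genFun (p t) (1 - w)) * Real.exp (w * L t)) =ᶠ[nhds 1]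
      fun w => 1 - genFun (p 0) (1 - w * Real.exp (-t))
        + mean (p 0) * ∫ s in (0 : ℝ)..t, w * Real.exp (s - t)
            * Real.exp (w * Real.exp (s - t) * L s) := by
    filter_upwards [Ioo_mem_nhds (by norm_num : (0 : ℝ) < 1) (by norm_num : (1 : ℝ) < 2)] with w hw
    exact hp.genFun_identity ht hw
  exact hleft.unique ((hright1.add (hright2.const_mul _)).congr_of_eventuallyEq hev)

/-- The mass of empty sites, weighted by `v`, decays through the memory term. -/
theorem IsClassicalSolution.empty_mul_exp_lag (hp : IsClassicalSolution p) {t : ℝ} (ht : 0 ≤ t) :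
    p t 0 * Real.exp (lag (fun s => activeMass (p s)) t)
      = p 0 0 * Real.exp (-∫ s in (0 : ℝ)..t, lag (fun s => activeMass (p s)) s) := by
  set L := lag (fun s => activeMass (p s)) with hL
  -- `p₀' = -a p₀`, while `L' + L = a`; hence this product is constant.
  have hd : ∀ s, 0 ≤ s → HasDerivWithinAt
      (fun s => p s 0 * Real.exp (L s + ∫ r in (0 : ℝ)..s, L r)) 0 (Set.Ici 0) s := by
    intro s hs
    have h1 := hp.hasDerivWithinAt_coord hs 0
    have h2 := (hasDerivWithinAt_lag hp.continuousOn_activeMass hs).add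
      (hasDerivWithinAt_integral_Ici (continuousOn_lag hp.continuousOn_activeMass) hs)
    refine (h1.mul h2.exp).congr_deriv ?_
    simp [generator]
    ring
  have h := constant_of_has_deriv_right_zero (a := 0) (b := t)
    (fun s hs => (hd s hs.1).continuousWithinAt.mono Set.Icc_subset_Ici_self)
    (fun s hs => (hd s hs.1).mono (Set.Ici_subset_Ici.2 hs.1)) t ⟨ht, le_rfl⟩
  simp only [intervalIntegral.integral_same, show L 0 = 0 from lag_zero _, add_zero,
    Real.exp_zero, mul_one, Real.exp_add] at h
  rw [← h, mul_assoc, mul_assoc, ← Real.exp_add, add_neg_cancel, Real.exp_zero, mul_one]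

theorem IsClassicalSolution.activeMass_eq (hp : IsClassicalSolution p) {t : ℝ} (ht : 0 ≤ t) :
    activeMass (p t) = mean (p 0) - p t 1 := by
  rw [(hp.state t ht).activeMass_eq, hp.mean_eq ht]

end Characteristics

/-! ### Comparison principle for linear Volterra inequalities -/

section Volterra

/-- A continuous subsolution of a linear Volterra equation with nonnegative kernel and positive
forcing lies below every positive supersolution. -/
theorem volterra_comparison {K : ℝ → ℝ → ℝ} {W S g : ℝ → ℝ}
    (hK : ∀ t s, 0 ≤ s → s ≤ t → 0 ≤ K t s) (hKc : ∀ t, Continuous (K t))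
    (hW : ContinuousOn W (Set.Ici 0)) (hS : ContinuousOn S (Set.Ici 0))
    (hS0 : ∀ t, 0 ≤ t → 0 < S t) (hg : ∀ t, 0 ≤ t → 0 < g t)
    (hWi : ∀ t, 0 ≤ t → W t ≤ (∫ s in (0 : ℝ)..t, K t s * W s) + g t)
    (hSi : ∀ t, 0 ≤ t → (∫ s in (0 : ℝ)..t, K t s * S s) + g t ≤ S t) {t : ℝ} (ht : 0 ≤ t) :
    W t ≤ S t := by
  have hq : ContinuousOn (fun s => W s / S s) (Set.Icc 0 t) :=
    (hW.mono Set.Icc_subset_Ici_self).div (hS.mono Set.Icc_subset_Ici_self)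
      fun s hs => (hS0 s hs.1).ne'
  obtain ⟨u, hu, hmax⟩ := isCompact_Icc.exists_isMaxOn (Set.nonempty_Icc.2 ht) hq
  set θ := W u / S u with hθ
  have hle : ∀ s ∈ Set.Icc 0 t, W s ≤ θ * S s := fun s hs =>
    (div_le_iff₀ (hS0 s hs.1)).1 (hmax hs)
  have hsub : Set.uIcc 0 u ⊆ Set.Ici 0 := by
    rw [Set.uIcc_of_le hu.1]; exact Set.Icc_subset_Ici_self
  have h1 : ∫ s in (0 : ℝ)..u, K u s * W s ≤ ∫ s in (0 : ℝ)..u, θ * (K u s * S s) := by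
    refine intervalIntegral.integral_mono_on hu.1
      (((hKc u).continuousOn.mul (hW.mono hsub)).intervalIntegrable)
      ((continuousOn_const.mul ((hKc u).continuousOn.mul (hS.mono hsub))).intervalIntegrable)
      fun s hs => ?_
    have := mul_le_mul_of_nonneg_left (hle s ⟨hs.1, hs.2.trans hu.2⟩) (hK u s hs.1 hs.2)
    linarith
  rw [intervalIntegral.integral_const_mul] at h1
  have hWu : W u = θ * S u := by rw [hθ, div_mul_cancel₀ _ (hS0 u hu.1).ne']
  have h2 := hWi u hu.1
  have h3 := hSi u hu.1
  have h4 := hg u hu.1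
  -- At the maximum point `u` of `W / S`, the two inequalities give `θ S u ≤ θ (S u - g u) + g u`,
  -- which is impossible for `θ > 1` because `g u > 0`.
  have hθ1 : θ ≤ 1 := by
    by_contra! hlt
    nlinarith
  have := hle t ⟨ht, le_rfl⟩
  nlinarith [hS0 t ht]

end Volterra

/-! ### The renewal kernel, its supersolutions and the nonlinear deviation -/

section Kernel

/-- The distribution function of the density `μ e^{-ν} e^y exp(ν e^y)` on `y ≤ 0`, which has total
mass one when `ν = μ (1 - e^{-ν})`. -/
noncomputable def kernelCdf (μ ν y : ℝ) : ℝ :=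
  μ / ν * Real.exp (-ν) * (Real.exp (ν * Real.exp y) - 1)

/-- The density `μ e^{-ν} e^y exp(ν e^y)`. -/
noncomputable def kernelDensity (μ ν y : ℝ) : ℝ :=
  μ * Real.exp (-ν) * Real.exp y * Real.exp (ν * Real.exp y)

variable {μ ν : ℝ}

theorem hasDerivAt_kernelCdf (hν : 0 < ν) (y : ℝ) :
    HasDerivAt (kernelCdf μ ν) (kernelDensity μ ν y) y := by
  refine ((((Real.hasDerivAt_exp y).const_mul ν).exp.sub_const 1).const_mul
    (μ / ν * Real.exp (-ν))).congr_deriv ?_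
  rw [kernelDensity]
  field_simp

theorem continuous_kernelDensity : Continuous (kernelDensity μ ν) := by
  unfold kernelDensity; fun_prop

theorem kernelDensity_nonneg (hμ : 0 < μ) (y : ℝ) : 0 ≤ kernelDensity μ ν y := by
  unfold kernelDensity; positivity

theorem kernelCdf_at_zero (hν : 0 < ν) (hfix : ν = μ * (1 - Real.exp (-ν))) :
    kernelCdf μ ν 0 = 1 := by
  have h : Real.exp (-ν) * Real.exp ν = 1 := by rw [← Real.exp_add]; simp
  rw [kernelCdf, Real.exp_zero, mul_one]
  calc μ / ν * Real.exp (-ν) * (Real.exp ν - 1)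
      = μ * (Real.exp (-ν) * Real.exp ν - Real.exp (-ν)) / ν := by ring
    _ = 1 := by rw [h, ← hfix, div_self hν.ne']

theorem le_kernelCdf (hμ : 0 < μ) (hν : 0 < ν) (y : ℝ) :
    μ * Real.exp (-ν) * Real.exp y ≤ kernelCdf μ ν y := by
  have h := Real.add_one_le_exp (ν * Real.exp y)
  have e : μ * Real.exp (-ν) * Real.exp y = μ / ν * Real.exp (-ν) * (ν * Real.exp y) := by
    field_simp
  rw [e, kernelCdf]
  gcongr
  linarith

theorem kernelCdf_le (hμ : 0 < μ) (hν : 0 < ν) {y : ℝ} (hy : y ≤ 0) :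
    kernelCdf μ ν y ≤ μ * Real.exp y := by
  have h1 : Real.exp (ν * Real.exp y) - 1 ≤ ν * Real.exp y * Real.exp ν := by
    have h2 := Real.add_one_le_exp (-(ν * Real.exp y))
    have h3 : Real.exp (-(ν * Real.exp y)) * Real.exp (ν * Real.exp y) = 1 := by
      rw [← Real.exp_add]; simp
    have h4 : Real.exp (ν * Real.exp y) ≤ Real.exp ν :=
      Real.exp_le_exp.2 (by nlinarith [Real.exp_le_one_iff.2 hy])
    have h5 : 0 ≤ ν * Real.exp y := by positivity
    nlinarith [Real.exp_pos (ν * Real.exp y)]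
  have h : Real.exp (-ν) * Real.exp ν = 1 := by rw [← Real.exp_add]; simp
  calc kernelCdf μ ν y ≤ μ / ν * Real.exp (-ν) * (ν * Real.exp y * Real.exp ν) := by
        rw [kernelCdf]; gcongr
    _ = μ * Real.exp y * (Real.exp (-ν) * Real.exp ν) := by field_simp
    _ = _ := by rw [h, mul_one]

/-- The defect `kernelCdf μ ν (-t)` is the kernel mass that falls on times before `0`. -/
theorem integral_kernelDensity (hν : 0 < ν) (hfix : ν = μ * (1 - Real.exp (-ν))) (t : ℝ) :
    ∫ s in (0 : ℝ)..t, kernelDensity μ ν (s - t) = 1 - kernelCdf μ ν (-t) := by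
  rw [intervalIntegral.integral_eq_sub_of_hasDerivAt (f := fun s => kernelCdf μ ν (s - t))]
  · simp [kernelCdf_at_zero hν hfix]
  · intro s _
    exact (hasDerivAt_kernelCdf hν (s - t)).comp_sub_const s t
  · exact (continuous_kernelDensity.comp (by fun_prop)).intervalIntegrable _ _

/-- Integration by parts, with `kernelCdf` bounded below by `μ e^{-ν} e^y`. The growth of `h` thus
opens a gap between `h` and its average against the kernel. `P` is a primitive of `e^{s-t} h'`, and
its value at `0` is absorbed by the boundary term. -/
theorem integral_kernelDensity_mul_le (hμ : 0 < μ) (hν : 0 < ν)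
    (hfix : ν = μ * (1 - Real.exp (-ν))) {h h' P : ℝ → ℝ} {t : ℝ} (ht : 0 ≤ t)
    (hh : ∀ s, HasDerivAt h (h' s) s) (hc : Continuous h') (h0 : ∀ s, 0 ≤ h' s)
    (hP : ∀ s, HasDerivAt P (Real.exp (s - t) * h' s) s) (hP0 : P 0 ≤ Real.exp (-t) * h 0)
    (hh0 : 0 ≤ h 0) :
    ∫ s in (0 : ℝ)..t, kernelDensity μ ν (s - t) * h s ≤ h t - μ * Real.exp (-ν) * P t := by
  have hhc : Continuous h := continuous_iff_continuousAt.2 fun s => (hh s).continuousAt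
  have hkc : Continuous fun s => kernelDensity μ ν (s - t) :=
    continuous_kernelDensity.comp (by fun_prop)
  have hFd (s : ℝ) : HasDerivAt (fun s => kernelCdf μ ν (s - t)) (kernelDensity μ ν (s - t)) s := by
    exact (hasDerivAt_kernelCdf hν (s - t)).comp_sub_const s t
  have hFc : Continuous fun s => kernelCdf μ ν (s - t) :=
    continuous_iff_continuousAt.2 fun s => (hFd s).continuousAt
  have hint : Continuous fun s => kernelDensity μ ν (s - t) * h s + kernelCdf μ ν (s - t) * h' s
      - μ * Real.exp (-ν) * (Real.exp (s - t) * h' s) := by fun_prop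
  have h1 : ∫ s in (0 : ℝ)..t, kernelDensity μ ν (s - t) * h s
      ≤ ∫ s in (0 : ℝ)..t, (kernelDensity μ ν (s - t) * h s + kernelCdf μ ν (s - t) * h' s
        - μ * Real.exp (-ν) * (Real.exp (s - t) * h' s)) := by
    refine intervalIntegral.integral_mono_on ht ((hkc.mul hhc).intervalIntegrable _ _)
      (hint.intervalIntegrable _ _) fun s _ => ?_
    have := mul_le_mul_of_nonneg_right (le_kernelCdf hμ hν (s - t)) (h0 s)
    linarith
  refine h1.trans ?_
  rw [intervalIntegral.integral_eq_sub_of_hasDerivAt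
    (f := fun s => kernelCdf μ ν (s - t) * h s - μ * Real.exp (-ν) * P s)
    (fun s _ => ((hFd s).mul (hh s)).sub ((hP s).const_mul _)) (hint.intervalIntegrable _ _)]
  have h2 := mul_le_mul_of_nonneg_right (le_kernelCdf hμ hν (-t)) hh0
  have h3 := mul_le_mul_of_nonneg_left hP0 (by positivity : 0 ≤ μ * Real.exp (-ν))
  simp only [sub_self, kernelCdf_at_zero hν hfix, zero_sub, one_mul]
  linarith

/-- Factoring `e^{-t}` out of the solution cancels the `e^{s-t}` in the kernel. The gap `c f` of `h`
then pays for the forcing, which fixes the constant `B / c`. -/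
theorem volterra_decay {W h f : ℝ → ℝ} {B c : ℝ} (hμ : 0 < μ)
    (hW : ContinuousOn W (Set.Ici 0)) (hh : Continuous h) (hh0 : ∀ t, 0 ≤ t → 0 < h t)
    (hf0 : ∀ t, 0 ≤ t → 0 < f t) (hB : 0 < B) (hc : 0 < c)
    (hker : ∀ t, 0 ≤ t → ∫ s in (0 : ℝ)..t, kernelDensity μ ν (s - t) * h s ≤ h t - c * f t)
    (hWi : ∀ t, 0 ≤ t → W t ≤ (∫ s in (0 : ℝ)..t, Real.exp (s - t) * kernelDensity μ ν (s - t) * W s)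
      + B * (Real.exp (-t) * f t)) {t : ℝ} (ht : 0 ≤ t) :
    W t ≤ B / c * (Real.exp (-t) * h t) := by
  refine volterra_comparison (K := fun t s => Real.exp (s - t) * kernelDensity μ ν (s - t))
    (S := fun t => B / c * (Real.exp (-t) * h t)) (g := fun t => B * (Real.exp (-t) * f t))
    (fun t s _ _ => mul_nonneg (Real.exp_pos _).le (kernelDensity_nonneg hμ _)) (fun t => ?_)
    hW (by fun_prop) (fun t ht => ?_) (fun t ht => ?_) hWi (fun t ht => ?_) ht
  · exact Continuous.mul (by fun_prop) (continuous_kernelDensity.comp (by fun_prop))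
  · have := hh0 t ht; positivity
  · have := hf0 t ht; positivity
  · have e : ∀ s, Real.exp (s - t) * kernelDensity μ ν (s - t) * (B / c * (Real.exp (-s) * h s))
        = B / c * Real.exp (-t) * (kernelDensity μ ν (s - t) * h s) := by
      intro s
      have : Real.exp (s - t) * Real.exp (-s) = Real.exp (-t) := by
        rw [← Real.exp_add]; ring_nf
      rw [← this]; ring
    simp only [e]
    rw [intervalIntegral.integral_const_mul]
    have h1 := mul_le_mul_of_nonneg_left (hker t ht)
      (by positivity : 0 ≤ B / c * Real.exp (-t))
    have h2 : B / c * Real.exp (-t) * (c * f t) = B * (Real.exp (-t) * f t) := by field_simp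
    linarith

theorem volterra_decay_subcritical {W : ℝ → ℝ} {B δ : ℝ} (hμ : 0 < μ) (hν : 0 < ν)
    (hfix : ν = μ * (1 - Real.exp (-ν))) (hδ : 0 < δ)
    (hW : ContinuousOn W (Set.Ici 0)) (hB : 0 < B)
    (hWi : ∀ t, 0 ≤ t → W t ≤ (∫ s in (0 : ℝ)..t, Real.exp (s - t) * kernelDensity μ ν (s - t) * W s)
      + B * (Real.exp (-t) * Real.exp (δ * t))) {t : ℝ} (ht : 0 ≤ t) :
    W t ≤ B / (μ * Real.exp (-ν) * (δ / (1 + δ))) * (Real.exp (-t) * Real.exp (δ * t)) := by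
  refine volterra_decay hμ hW (by fun_prop) (fun t _ => Real.exp_pos _) (fun t _ => Real.exp_pos _)
    hB (by positivity) (fun t ht => ?_) hWi ht
  have := integral_kernelDensity_mul_le hμ hν hfix (h := fun s => Real.exp (δ * s))
    (h' := fun s => δ * Real.exp (δ * s))
    (P := fun s => δ / (1 + δ) * (Real.exp (s - t) * Real.exp (δ * s))) ht
    (fun s => by
      simpa [mul_comm] using ((hasDerivAt_id s).const_mul δ).exp) (by fun_prop)
    (fun s => by positivity)
    (fun s => by
      have h1 := ((hasDerivAt_id s).sub_const t).exp.mul ((hasDerivAt_id s).const_mul δ).exp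
      refine (h1.const_mul (δ / (1 + δ))).congr_deriv ?_
      simp
      field_simp)
    (by
      simp only [mul_zero, Real.exp_zero, mul_one, zero_sub]
      refine mul_le_of_le_one_left (Real.exp_pos _).le ?_
      rw [div_le_one (by linarith)]; linarith)
    (Real.exp_pos _).le
  simpa [mul_assoc] using this

theorem volterra_decay_critical {W : ℝ → ℝ} {B : ℝ} (hμ : 0 < μ) (hν : 0 < ν)
    (hfix : ν = μ * (1 - Real.exp (-ν)))
    (hW : ContinuousOn W (Set.Ici 0)) (hB : 0 < B)
    (hWi : ∀ t, 0 ≤ t → W t ≤ (∫ s in (0 : ℝ)..t, Real.exp (s - t) * kernelDensity μ ν (s - t) * W s)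
      + B * Real.exp (-t)) {t : ℝ} (ht : 0 ≤ t) :
    W t ≤ B / (μ * Real.exp (-ν)) * (Real.exp (-t) * (1 + t)) := by
  refine volterra_decay (f := fun _ => 1) hμ hW (by fun_prop) (fun t ht => by linarith)
    (fun t _ => one_pos) hB (by positivity) (fun t ht => ?_) (by simpa using hWi) ht
  have := integral_kernelDensity_mul_le hμ hν hfix (h := fun s => 1 + s) (h' := fun _ => 1)
    (P := fun s => Real.exp (s - t)) ht
    (fun s => by simpa using (hasDerivAt_id s).const_add 1) (by fun_prop)
    (fun s => zero_le_one)
    (fun s => by simpa using ((hasDerivAt_id s).sub_const t).exp)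
    (by simp) (by simp)
  simpa using this

/-- Solutions of the nonlinear integral equation deviate from `ν`, measured by `e^{|L - ν|} - 1`,
at most by a linear Volterra term and the forcing. -/
theorem exp_abs_sub_one_le (hμ : 0 < μ) (hν : 0 < ν) (hfix : ν = μ * (1 - Real.exp (-ν)))
    {L : ℝ → ℝ} (hL : ContinuousOn L (Set.Ici 0)) (hL0 : ∀ t, 0 ≤ t → 0 ≤ L t)
    {t ξ : ℝ} (ht : 0 ≤ t) (hξ : 0 ≤ ξ)
    (heq : Real.exp (L t)
      = μ * (∫ s in (0 : ℝ)..t, Real.exp (s - t) * Real.exp (Real.exp (s - t) * L s)) + ξ) :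
    Real.exp |L t - ν| - 1
      ≤ (∫ s in (0 : ℝ)..t, Real.exp (s - t) * kernelDensity μ ν (s - t)
          * (Real.exp |L s - ν| - 1))
        + Real.exp (2 * ν) * (ξ + μ * Real.exp (-t)) := by
  have hsub : Set.uIcc 0 t ⊆ Set.Ici (0 : ℝ) := by
    rw [Set.uIcc_of_le ht]; exact Set.Icc_subset_Ici_self
  have hLc := hL.mono hsub
  have hkc : Continuous fun s => kernelDensity μ ν (s - t) :=
    continuous_kernelDensity.comp (by fun_prop)
  have hE : Continuous fun s : ℝ => Real.exp (s - t) := by fun_prop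
  have hDc : ContinuousOn (fun s => Real.exp (s - t) * (L s - ν)) (Set.uIcc 0 t) :=
    hE.continuousOn.mul (hLc.sub continuousOn_const)
  have hi0 := hkc.intervalIntegrable (μ := MeasureTheory.volume) 0 t
  have hi1 : IntervalIntegrable (fun s => kernelDensity μ ν (s - t)
      * Real.exp (Real.exp (s - t) * (L s - ν))) MeasureTheory.volume 0 t :=
    (hkc.continuousOn.mul (Real.continuous_exp.comp_continuousOn hDc)).intervalIntegrable
  have hi2 : IntervalIntegrable (fun s => kernelDensity μ ν (s - t)
      * Real.exp (-(Real.exp (s - t) * (L s - ν)))) MeasureTheory.volume 0 t :=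
    (hkc.continuousOn.mul (Real.continuous_exp.comp_continuousOn hDc.neg)).intervalIntegrable
  have hi3 : IntervalIntegrable (fun s => Real.exp (s - t) * kernelDensity μ ν (s - t)
      * (Real.exp |L s - ν| - 1)) MeasureTheory.volume 0 t :=
    ((hE.mul hkc).continuousOn.mul ((Real.continuous_exp.comp_continuousOn
      (hLc.sub continuousOn_const).abs).sub continuousOn_const)).intervalIntegrable
  set J := ∫ s in (0 : ℝ)..t, kernelDensity μ ν (s - t)
      * Real.exp (Real.exp (s - t) * (L s - ν)) with hJ
  set J' := ∫ s in (0 : ℝ)..t, kernelDensity μ ν (s - t)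
      * Real.exp (-(Real.exp (s - t) * (L s - ν))) with hJ'
  set I := ∫ s in (0 : ℝ)..t, Real.exp (s - t) * kernelDensity μ ν (s - t)
      * (Real.exp |L s - ν| - 1) with hI
  set ρ := kernelCdf μ ν (-t) with hρ
  have hI0 := integral_kernelDensity hν hfix t
  rw [← hρ] at hI0
  have hρ0 : 0 ≤ ρ := le_trans (by positivity) (le_kernelCdf hμ hν (-t))
  have hρ1 : ρ ≤ 1 := by
    have : 0 ≤ ∫ s in (0 : ℝ)..t, kernelDensity μ ν (s - t) :=
      intervalIntegral.integral_nonneg ht fun s _ => kernelDensity_nonneg hμ _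
    linarith
  have hρ2 : ρ ≤ μ * Real.exp (-t) := kernelCdf_le hμ hν (by linarith)
  -- Convexity on the chord from `0` to `x`. The factor `E = e^{s-t}` it extracts is the additional
  -- discount in the Volterra kernel.
  have hchord : ∀ E x : ℝ, 0 ≤ E → E ≤ 1 → Real.exp (E * x) ≤ 1 + E * (Real.exp |x| - 1) := by
    intro E x h0 h1
    have h2 := convexOn_exp.2 (Set.mem_univ 0) (Set.mem_univ x) (sub_nonneg.2 h1) h0 (by ring)
    simp only [smul_eq_mul, mul_zero, zero_add, Real.exp_zero, mul_one] at h2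
    have h3 : Real.exp x ≤ Real.exp |x| := Real.exp_le_exp.2 (le_abs_self x)
    nlinarith
  have hE1 : ∀ s ∈ Set.Icc 0 t, Real.exp (s - t) ≤ 1 := fun s hs =>
    Real.exp_le_one_iff.2 (by linarith [hs.2])
  have hup : J ≤ 1 - ρ + I := by
    rw [← hI0, ← intervalIntegral.integral_add hi0 hi3]
    refine intervalIntegral.integral_mono_on ht hi1 (hi0.add hi3) fun s hs => ?_
    have := mul_le_mul_of_nonneg_left (hchord _ (L s - ν) (Real.exp_pos (s - t)).le (hE1 s hs))
      (kernelDensity_nonneg (ν := ν) hμ (s - t))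
    linarith
  have hup' : J' ≤ 1 - ρ + I := by
    rw [← hI0, ← intervalIntegral.integral_add hi0 hi3]
    refine intervalIntegral.integral_mono_on ht hi2 (hi0.add hi3) fun s hs => ?_
    have := mul_le_mul_of_nonneg_left (hchord _ (-(L s - ν)) (Real.exp_pos (s - t)).le (hE1 s hs))
      (kernelDensity_nonneg (ν := ν) hμ (s - t))
    rw [abs_neg, mul_neg] at this
    linarith
  have hlow : Real.exp (-ν) * (1 - ρ) ≤ J := by
    rw [← hI0, ← intervalIntegral.integral_const_mul]
    refine intervalIntegral.integral_mono_on ht (hi0.const_mul _) hi1 fun s hs => ?_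
    rw [mul_comm]
    refine mul_le_mul_of_nonneg_left (Real.exp_le_exp.2 ?_) (kernelDensity_nonneg hμ _)
    nlinarith [hL0 s hs.1, hE1 s hs, Real.exp_pos (s - t)]
  have hexp : Real.exp (-ν) ≤ 1 := Real.exp_le_one_iff.2 (by linarith)
  -- `M` is the mean of `e^{e^{s-t}(L-ν)}` under the full probability kernel, when `L` is given the
  -- value `ν` before time `0`.
  set M := J + ρ with hM
  have hMν : Real.exp (-ν) ≤ M := by nlinarith
  have hM0 : 0 < M := (Real.exp_pos _).trans_le hMν
  have hJe : Real.exp (-ν) * (μ * ∫ s in (0 : ℝ)..t, Real.exp (s - t)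
      * Real.exp (Real.exp (s - t) * L s)) = J := by
    rw [hJ, ← mul_assoc, ← intervalIntegral.integral_const_mul]
    refine intervalIntegral.integral_congr fun s _ => ?_
    have : Real.exp (Real.exp (s - t) * L s)
        = Real.exp (ν * Real.exp (s - t)) * Real.exp (Real.exp (s - t) * (L s - ν)) := by
      rw [← Real.exp_add]; ring_nf
    simp only [this, kernelDensity]
    ring
  have hD : Real.exp (L t - ν) = M + (Real.exp (-ν) * ξ - ρ) := by
    rw [sub_eq_add_neg, Real.exp_add, mul_comm, heq, mul_add, hJe, hM]
    ring
  set ε := Real.exp (-ν) * ξ - ρ with hε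
  have hεle : |ε| ≤ ξ + μ * Real.exp (-t) := by
    rw [abs_le]
    have h1 := mul_le_mul_of_nonneg_right hexp hξ
    have h2 := mul_nonneg (Real.exp_pos (-ν)).le hξ
    constructor <;> linarith [(mul_pos hμ (Real.exp_pos (-t))).le]
  have hnn : 0 ≤ ξ + μ * Real.exp (-t) := (abs_nonneg _).trans hεle
  have hexp2 : 1 ≤ Real.exp (2 * ν) := Real.one_le_exp (by linarith)
  have hfin : Real.exp (2 * ν) * |ε| ≤ Real.exp (2 * ν) * (ξ + μ * Real.exp (-t)) :=
    mul_le_mul_of_nonneg_left hεle (Real.exp_pos _).le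
  rcases le_total 0 (L t - ν) with hs | hs
  · rw [abs_of_nonneg hs, hD]
    have := le_abs_self ε
    have := mul_le_mul_of_nonneg_right hexp2 (abs_nonneg ε)
    linarith
  · rw [abs_of_nonpos hs]
    -- For `L < ν` the reciprocal `e^{ν-L}` has to be bounded. The tangent of `1/x` at `x = M`,
    -- integrated against the kernel, is Jensen's inequality; `hinv` adds the mass `ρ` placed at `x
    -- = 1`.
    have htan : 2 / M * (1 - ρ) - 1 / M ^ 2 * J ≤ J' := by
      rw [← hI0, hJ, ← intervalIntegral.integral_const_mul, ← intervalIntegral.integral_const_mul,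
        ← intervalIntegral.integral_sub (hi0.const_mul _) (hi1.const_mul _)]
      refine intervalIntegral.integral_mono_on ht ((hi0.const_mul _).sub (hi1.const_mul _)) hi2
        fun s _ => ?_
      have hx := Real.exp_pos (Real.exp (s - t) * (L s - ν))
      rw [Real.exp_neg]
      set x := Real.exp (Real.exp (s - t) * (L s - ν))
      have h1 : 2 / M - 1 / M ^ 2 * x ≤ x⁻¹ := by
        have : x⁻¹ - (2 / M - 1 / M ^ 2 * x) = (x - M) ^ 2 / (x * M ^ 2) := by
          field_simp; ring
        have h2 : 0 ≤ (x - M) ^ 2 / (x * M ^ 2) := by positivity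
        linarith
      have := mul_le_mul_of_nonneg_left h1 (kernelDensity_nonneg (ν := ν) hμ (s - t))
      linarith
    have hinv : 1 / M ≤ J' + ρ := by
      have h1 : 2 / M * (1 - ρ) - 1 / M ^ 2 * J + ρ - 1 / M = ρ * (1 - 1 / M) ^ 2 := by
        have : J = M - ρ := by rw [hM]; ring
        rw [this]; field_simp; ring
      have h2 : 0 ≤ ρ * (1 - 1 / M) ^ 2 := by positivity
      linarith
    have hDpos := Real.exp_pos (L t - ν)
    have hDν : Real.exp (-(L t - ν)) ≤ Real.exp ν :=
      Real.exp_le_exp.2 (by linarith [hL0 t ht])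
    have hMinv : 1 / M ≤ Real.exp ν := by
      rw [div_le_iff₀ hM0]
      have : Real.exp ν * Real.exp (-ν) = 1 := by rw [← Real.exp_add]; simp
      nlinarith [Real.exp_pos ν]
    -- This is `1/(M+ε) = 1/M - ε/(M(M+ε))`. As `L ≥ 0`, both reciprocals are at most `e^ν`, whence
    -- the constant `e^{2ν}`.
    have hdiff : Real.exp (-(L t - ν)) = 1 / M + Real.exp (-(L t - ν)) * (1 / M) * -ε := by
      rw [Real.exp_neg, hD]
      rw [hD] at hDpos
      field_simp
      ring
    have hprod : Real.exp (-(L t - ν)) * (1 / M) ≤ Real.exp (2 * ν) := by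
      rw [two_mul, Real.exp_add]
      exact mul_le_mul hDν hMinv (by positivity) (Real.exp_pos _).le
    have hlast : Real.exp (-(L t - ν)) * (1 / M) * -ε ≤ Real.exp (2 * ν) * |ε| :=
      (mul_le_mul_of_nonneg_left (neg_le_abs ε) (by positivity)).trans
        (mul_le_mul_of_nonneg_right hprod (abs_nonneg ε))
    linarith

end Kernel

/-! ### The equation defining `ν` -/

section FixedPoint

variable {μ : ℝ}

theorem lambertW0_neg_mul_exp_neg (μ : ℝ) :
    -1 ≤ lambertW0 (-μ * Real.exp (-μ)) ∧
      lambertW0 (-μ * Real.exp (-μ)) * Real.exp (lambertW0 (-μ * Real.exp (-μ)))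
        = -μ * Real.exp (-μ) := by
  refine (lambertW0_eq_iff ?_ _).1 rfl
  -- `μ ≤ e^{μ-1}` puts the argument in the domain `x ≥ -e⁻¹` of the principal branch.
  have h1 := Real.add_one_le_exp (μ - 1)
  have h2 : Real.exp (-1) = Real.exp (μ - 1) * Real.exp (-μ) := by
    rw [← Real.exp_add]; ring_nf
  rw [h2]
  nlinarith [Real.exp_pos (-μ)]

/-- The fixed point equation also has the root `0`; the bound `W₀ ≥ -1` excludes it, since it gives
`ν ≥ μ - 1`. -/
theorem nu_pos (hμ : 1 < μ) : 0 < nu μ := by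
  have := (lambertW0_neg_mul_exp_neg μ).1
  rw [nu]
  linarith

theorem nu_eq (μ : ℝ) : nu μ = μ * (1 - Real.exp (-nu μ)) := by
  have h := (lambertW0_neg_mul_exp_neg μ).2
  rw [nu]
  set w := lambertW0 (-μ * Real.exp (-μ))
  have h1 : w = -μ * Real.exp (-(μ + w)) := by
    have h2 : Real.exp w * Real.exp (-w) = 1 := by rw [← Real.exp_add]; simp
    calc w = w * Real.exp w * Real.exp (-w) := by rw [mul_assoc, h2, mul_one]
      _ = -μ * Real.exp (-(μ + w)) := by rw [h, neg_add, Real.exp_add]; ring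
  linarith

theorem nu_le (hμ : 1 < μ) : nu μ ≤ μ := by
  rw [nu_eq μ]
  nlinarith [Real.exp_pos (-nu μ)]

end FixedPoint

/-! ### Bootstrap for the memory term -/

section Memory

/-- The logarithm of `auxV`. -/
noncomputable def auxLog (p : ℝ → EllInfty) : ℝ → ℝ := lag fun s => activeMass (p s)

theorem auxV_eq (p : ℝ → EllInfty) (t : ℝ) : auxV p t = Real.exp (auxLog p t) := rfl

variable {p : ℝ → EllInfty} {μ : ℝ}

theorem IsClassicalSolution.continuousOn_auxLog (hp : IsClassicalSolution p) :
    ContinuousOn (auxLog p) (Set.Ici 0) :=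
  continuousOn_lag hp.continuousOn_activeMass

theorem IsClassicalSolution.hasDerivWithinAt_auxV (hp : IsClassicalSolution p) {t : ℝ}
    (ht : 0 ≤ t) :
    HasDerivWithinAt (auxV p) (auxV p t * (activeMass (p t) - auxLog p t)) (Set.Ici 0) t :=
  (hasDerivWithinAt_lag hp.continuousOn_activeMass ht).exp

theorem IsClassicalSolution.le_auxLog (hp : IsClassicalSolution p) (hm : mean (p 0) = μ)
    {t : ℝ} (ht : 0 ≤ t) : (μ - 1) * (1 - Real.exp (-t)) ≤ auxLog p t := by
  refine mul_le_lag hp.continuousOn_activeMass (fun s hs => ?_) ht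
  rw [hp.activeMass_eq hs, hm]
  linarith [(hp.state s hs).le_one 1]

theorem IsClassicalSolution.auxLog_nonneg (hp : IsClassicalSolution p) {t : ℝ} (ht : 0 ≤ t) :
    0 ≤ auxLog p t := by
  have h := mul_le_lag hp.continuousOn_activeMass
    (fun s hs => (hp.state s hs).activeMass_nonneg) ht
  rwa [zero_mul] at h

theorem IsClassicalSolution.auxLog_le (hp : IsClassicalSolution p) (hm : mean (p 0) = μ)
    (hμ : 0 < μ) {t : ℝ} (ht : 0 ≤ t) : auxLog p t ≤ μ := by
  have h := lag_le_mul hp.continuousOn_activeMass (c := μ) (fun s hs => by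
    rw [hp.activeMass_eq hs, hm]
    linarith [(hp.state s hs).nonneg 1]) ht
  refine h.trans ?_
  nlinarith [Real.exp_pos (-t)]

theorem IsClassicalSolution.empty_mul_exp_auxLog_le (hp : IsClassicalSolution p) {t : ℝ}
    (ht : 0 ≤ t) :
    p t 0 * Real.exp (auxLog p t) ≤ Real.exp (-∫ s in (0 : ℝ)..t, auxLog p s) := by
  rw [auxLog, hp.empty_mul_exp_lag ht]
  exact mul_le_of_le_one_left (Real.exp_pos _).le ((hp.state 0 le_rfl).le_one 0)

/-- The linear Volterra inequality for the deviation of `auxLog` from `ν`. -/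
theorem IsClassicalSolution.deviation_le (hp : IsClassicalSolution p) (hm : mean (p 0) = μ)
    (hμ : 1 < μ) {t : ℝ} (ht : 0 ≤ t) :
    Real.exp |auxLog p t - nu μ| - 1
      ≤ (∫ s in (0 : ℝ)..t, Real.exp (s - t) * kernelDensity μ (nu μ) (s - t)
          * (Real.exp |auxLog p s - nu μ| - 1))
        + Real.exp (2 * nu μ) * (2 * μ * Real.exp (-t)
            + Real.exp (-∫ s in (0 : ℝ)..t, auxLog p s)) := by
  -- At `w = 1` the left-hand generating function is evaluated at `0`, so only `p₀` survives and
  -- joins the forcing.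
  have hid := hp.genFun_identity ht (w := 1) (by norm_num)
  simp only [sub_self, genFun_at_zero, one_mul, hm] at hid
  change _ * Real.exp (auxLog p t) = _ + _ * ∫ s in (0 : ℝ)..t, Real.exp (s - t)
    * Real.exp (Real.exp (s - t) * auxLog p s) at hid
  have hG := (hp.state 0 le_rfl).one_sub_genFun_mem (Real.exp_pos (-t))
    (Real.exp_le_one_iff.2 (by linarith))
  rw [hm] at hG
  have hR := hp.empty_mul_exp_auxLog_le ht
  have hR0 : 0 ≤ p t 0 * Real.exp (auxLog p t) :=
    mul_nonneg ((hp.state t ht).nonneg 0) (Real.exp_pos _).le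
  refine (exp_abs_sub_one_le (by linarith) (nu_pos hμ) (nu_eq μ) hp.continuousOn_auxLog
    (fun s hs => hp.auxLog_nonneg hs) ht
    (ξ := 1 - genFun (p 0) (1 - Real.exp (-t)) + p t 0 * Real.exp (auxLog p t))
    (by linarith [hG.1]) (by linarith)).trans
    (add_le_add le_rfl (mul_le_mul_of_nonneg_left (by linarith [hG.2]) (Real.exp_pos _).le))

theorem IsClassicalSolution.continuousOn_deviation (hp : IsClassicalSolution p) (ν : ℝ) :
    ContinuousOn (fun t => Real.exp |auxLog p t - ν| - 1) (Set.Ici 0) :=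
  (Real.continuous_exp.comp_continuousOn
    (hp.continuousOn_auxLog.sub continuousOn_const).abs).sub continuousOn_const

theorem IsClassicalSolution.intervalIntegrable_auxLog (hp : IsClassicalSolution p) {t : ℝ}
    (ht : 0 ≤ t) : IntervalIntegrable (auxLog p) MeasureTheory.volume 0 t := by
  refine (hp.continuousOn_auxLog.mono ?_).intervalIntegrable
  rw [Set.uIcc_of_le ht]
  exact Set.Icc_subset_Ici_self

theorem IsClassicalSolution.exp_neg_integral_auxLog_le_of_mean (hp : IsClassicalSolution p)
    (hm : mean (p 0) = μ) (hμ : 1 < μ) {t : ℝ} (ht : 0 ≤ t) :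
    Real.exp (-∫ s in (0 : ℝ)..t, auxLog p s) ≤ Real.exp (μ - 1) * Real.exp (-((μ - 1) * t)) := by
  rw [← Real.exp_add]
  refine Real.exp_le_exp.2 ?_
  have h1 : ∫ s in (0 : ℝ)..t, (μ - 1) * (1 - Real.exp (-s)) ≤ ∫ s in (0 : ℝ)..t, auxLog p s :=
    intervalIntegral.integral_mono_on ht (Continuous.intervalIntegrable (by fun_prop) _ _)
      (hp.intervalIntegrable_auxLog ht) fun s hs => hp.le_auxLog hm hs.1
  rw [intervalIntegral.integral_eq_sub_of_hasDerivAt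
    (f := fun s => (μ - 1) * (s + Real.exp (-s)))
    (fun s _ => by
      refine (((hasDerivAt_id s).add (hasDerivAt_neg s).exp).const_mul (μ - 1)).congr_deriv ?_
      ring)
    (Continuous.intervalIntegrable (by fun_prop) _ _)] at h1
  simp only [neg_zero, Real.exp_zero, zero_add, mul_one] at h1
  nlinarith [Real.exp_pos (-t)]

theorem abs_le_exp_abs_sub_one (x : ℝ) : |x| ≤ Real.exp |x| - 1 := by
  linarith [Real.add_one_le_exp |x|]

/-- The forcing by empty sites decays at rate `ν`, uniformly over all solutions with mean `μ`. -/
theorem exists_exp_neg_integral_auxLog_le (hμ : 1 < μ) :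
    ∃ C : ℝ, 0 < C ∧ ∀ p : ℝ → EllInfty, IsClassicalSolution p → mean (p 0) = μ →
      ∀ t : ℝ, 0 ≤ t →
        Real.exp (-∫ s in (0 : ℝ)..t, auxLog p s) ≤ C * Real.exp (-nu μ * t) := by
  have hμ0 : 0 < μ := by linarith
  -- The preliminary rate: `l ≤ μ - 1` so that the crude forcing decays at least as `e^{-lt}`, and
  -- `l ≤ 1/2` so that `δ = 1 - l` is positive.
  set l := min (μ - 1) (1 / 2) with hl
  have hl0 : 0 < l := lt_min (by linarith) (by norm_num)
  have hl1 : l ≤ μ - 1 := min_le_left _ _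
  have hl2 : l ≤ 1 / 2 := min_le_right _ _
  set B := Real.exp (2 * nu μ) * (2 * μ + Real.exp (μ - 1)) with hB
  have hB0 : 0 < B := by positivity
  set A := B / (μ * Real.exp (-nu μ) * ((1 - l) / (1 + (1 - l)))) with hA
  have hA0 : 0 < A := by
    have : 0 < 1 - l := by linarith
    positivity
  -- `A / l` is the integral of `A e^{-ls}` over the half line, a bound for the time integral of `|L
  -- - ν|`.
  refine ⟨Real.exp (A / l), Real.exp_pos _, fun p hp hm t ht => ?_⟩
  have hdecay : ∀ s, 0 ≤ s → |auxLog p s - nu μ| ≤ A * Real.exp (-(l * s)) := by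
    intro s hs
    refine (abs_le_exp_abs_sub_one _).trans ?_
    have h := volterra_decay_subcritical hμ0 (nu_pos hμ) (nu_eq μ) (δ := 1 - l) (by linarith)
      (hp.continuousOn_deviation (nu μ)) hB0 (fun u hu => ?_) hs
    · rw [← Real.exp_add, show -s + (1 - l) * s = -(l * s) by ring] at h
      exact h
    · refine (hp.deviation_le hm hμ hu).trans ?_
      have h1 := hp.exp_neg_integral_auxLog_le_of_mean hm hμ hu
      have h2 : Real.exp (-((μ - 1) * u)) ≤ Real.exp (-(l * u)) :=
        Real.exp_le_exp.2 (by nlinarith)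
      have h3 : Real.exp (-u) ≤ Real.exp (-(l * u)) := Real.exp_le_exp.2 (by nlinarith)
      rw [← Real.exp_add (-u), show -u + (1 - l) * u = -(l * u) by ring, hB,
        mul_assoc (Real.exp (2 * nu μ)), add_mul]
      have h4 : Real.exp (μ - 1) * Real.exp (-((μ - 1) * u))
          ≤ Real.exp (μ - 1) * Real.exp (-(l * u)) := by gcongr
      gcongr
      exact h1.trans h4
  rw [← Real.exp_add]
  refine Real.exp_le_exp.2 ?_
  have h1 : ∫ s in (0 : ℝ)..t, (nu μ - A * Real.exp (-(l * s))) ≤ ∫ s in (0 : ℝ)..t, auxLog p s :=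
    intervalIntegral.integral_mono_on ht (Continuous.intervalIntegrable (by fun_prop) _ _)
      (hp.intervalIntegrable_auxLog ht) fun s hs => by
        have := (abs_le.1 (hdecay s hs.1)).1
        linarith
  rw [intervalIntegral.integral_eq_sub_of_hasDerivAt
    (f := fun s => nu μ * s + A / l * Real.exp (-(l * s)))
    (fun s _ => by
      have h2 := ((hasDerivAt_id s).const_mul l).neg.exp.const_mul (A / l)
      refine (((hasDerivAt_id s).const_mul (nu μ)).add h2).congr_deriv ?_
      simp
      field_simp
      ring)
    (Continuous.intervalIntegrable (by fun_prop) _ _)] at h1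
  simp only [mul_zero, neg_zero, Real.exp_zero, zero_add, mul_one] at h1
  have : 0 ≤ A / l * Real.exp (-(l * t)) := by positivity
  linarith

theorem exists_deviation_le_subcritical (hμ : 1 < μ) (hν : nu μ < 1) :
    ∃ C : ℝ, 0 < C ∧ ∀ p : ℝ → EllInfty, IsClassicalSolution p → mean (p 0) = μ →
      ∀ t : ℝ, 0 ≤ t → Real.exp |auxLog p t - nu μ| - 1 ≤ C * Real.exp (-nu μ * t) := by
  have hμ0 : 0 < μ := by linarith
  obtain ⟨C, hC, h⟩ := exists_exp_neg_integral_auxLog_le hμ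
  have hδ : 0 < 1 - nu μ := by linarith
  set B := Real.exp (2 * nu μ) * (2 * μ + C) with hB
  have hB0 : 0 < B := by positivity
  refine ⟨B / (μ * Real.exp (-nu μ) * ((1 - nu μ) / (1 + (1 - nu μ)))), by positivity,
    fun p hp hm t ht => ?_⟩
  have key := volterra_decay_subcritical hμ0 (nu_pos hμ) (nu_eq μ) hδ
      (hp.continuousOn_deviation (nu μ)) hB0 (fun u hu => ?_) ht
  · rwa [← Real.exp_add (-t), show -t + (1 - nu μ) * t = -nu μ * t by ring] at key
  · refine (hp.deviation_le hm hμ hu).trans ?_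
    have h1 := h p hp hm u hu
    have h3 : Real.exp (-u) ≤ Real.exp (-nu μ * u) := Real.exp_le_exp.2 (by nlinarith)
    rw [← Real.exp_add (-u), show -u + (1 - nu μ) * u = -nu μ * u by ring, hB,
      mul_assoc (Real.exp (2 * nu μ)), add_mul]
    gcongr

/-- Both parts of the forcing are now of order `e^{-t}`, the rate at which the kernel is critical;
this resonance costs the factor `1 + t`. -/
theorem exists_deviation_le_supercritical (hμ : 1 < μ) (hν : 1 ≤ nu μ) :
    ∃ C : ℝ, 0 < C ∧ ∀ p : ℝ → EllInfty, IsClassicalSolution p → mean (p 0) = μ →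
      ∀ t : ℝ, 0 ≤ t → Real.exp |auxLog p t - nu μ| - 1 ≤ C * (Real.exp (-t) * (1 + t)) := by
  have hμ0 : 0 < μ := by linarith
  obtain ⟨C, hC, h⟩ := exists_exp_neg_integral_auxLog_le hμ
  set B := Real.exp (2 * nu μ) * (2 * μ + C) with hB
  have hB0 : 0 < B := by positivity
  refine ⟨B / (μ * Real.exp (-nu μ)), by positivity, fun p hp hm t ht => ?_⟩
  refine volterra_decay_critical hμ0 (nu_pos hμ) (nu_eq μ)
      (hp.continuousOn_deviation (nu μ)) hB0 (fun u hu => ?_) ht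
  refine (hp.deviation_le hm hμ hu).trans ?_
  have h1 := h p hp hm u hu
  have h3 : Real.exp (-nu μ * u) ≤ Real.exp (-u) := Real.exp_le_exp.2 (by nlinarith)
  have h4 : C * Real.exp (-nu μ * u) ≤ C * Real.exp (-u) := by gcongr
  rw [hB, mul_assoc (Real.exp (2 * nu μ)), add_mul]
  gcongr
  exact h1.trans h4

end Memory

/-! ### From the memory term to `v`, `v'`, `y₂` and `p₁` -/

section Convergence

variable {p : ℝ → EllInfty} {μ : ℝ}

theorem abs_exp_sub_exp_le (x y : ℝ) :
    |Real.exp x - Real.exp y| ≤ Real.exp y * (Real.exp |x - y| - 1) := by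
  have h : Real.exp x - Real.exp y = Real.exp y * (Real.exp (x - y) - 1) := by
    rw [mul_sub, ← Real.exp_add]; ring_nf
  rw [h, abs_mul, abs_of_pos (Real.exp_pos y)]
  refine mul_le_mul_of_nonneg_left ?_ (Real.exp_pos y).le
  have h1 : Real.exp (x - y) ≤ Real.exp |x - y| := Real.exp_le_exp.2 (le_abs_self _)
  have h2 := Real.add_one_le_exp (x - y)
  have h3 := Real.add_one_le_exp |x - y|
  rw [abs_le]
  constructor <;> linarith [neg_abs_le (x - y)]

theorem abs_one_add_mul_exp_sub_le {μ x y : ℝ} (hx : x ∈ Set.Icc 0 μ) (hy : y ∈ Set.Icc 0 μ) :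
    |(1 + x) * Real.exp x - (1 + y) * Real.exp y| ≤ (2 + μ) * Real.exp μ * |x - y| := by
  refine (convex_Icc 0 μ).norm_image_sub_le_of_norm_hasDerivWithin_le
    (f := fun x => (1 + x) * Real.exp x) (f' := fun x => (2 + x) * Real.exp x)
    (fun z _ => ?_) (fun z hz => ?_) hy hx
  · refine ((((hasDerivAt_id z).const_add 1).mul (Real.hasDerivAt_exp z)).congr_deriv
      ?_).hasDerivWithinAt
    simp
    ring
  · have h1 : 0 ≤ 2 + z := by linarith [hz.1]
    rw [Real.norm_of_nonneg (by positivity)]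
    have := hz.2
    have : 0 ≤ 2 + μ := by linarith
    gcongr

theorem integral_exp_sub_mul_one_add_mul_exp (ν t : ℝ) :
    ∫ s in (0 : ℝ)..t, Real.exp (s - t) * (1 + Real.exp (s - t) * ν)
        * Real.exp (Real.exp (s - t) * ν)
      = Real.exp ν - Real.exp (-t) * Real.exp (Real.exp (-t) * ν) := by
  rw [intervalIntegral.integral_eq_sub_of_hasDerivAt
    (f := fun s => Real.exp (s - t) * Real.exp (Real.exp (s - t) * ν))
    (fun s _ => by
      have h := ((hasDerivAt_id s).sub_const t).exp
      refine (h.mul (h.mul_const ν).exp).congr_deriv ?_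
      simp
      ring)
    (Continuous.intervalIntegrable (by fun_prop) _ _)]
  simp

/-- A discounted integral of a rate function `b` with `e^t b(t)` monotone is controlled by `b`. -/
theorem integral_discount_le {f b : ℝ → ℝ} {c t : ℝ} (ht : 0 ≤ t) (hc : 0 ≤ c)
    (hf : ∀ s ∈ Set.Icc 0 t, f s ≤ Real.exp (2 * (s - t)) * (c * b s))
    (hfi : IntervalIntegrable f MeasureTheory.volume 0 t)
    (hb0 : 0 ≤ b t) (hb : ∀ s ∈ Set.Icc 0 t, Real.exp s * b s ≤ Real.exp t * b t) :
    ∫ s in (0 : ℝ)..t, f s ≤ c * b t := by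
  have h1 : ∫ s in (0 : ℝ)..t, f s ≤ ∫ s in (0 : ℝ)..t, Real.exp (-t + s) * (c * b t) := by
    refine intervalIntegral.integral_mono_on ht hfi
      (Continuous.intervalIntegrable (by fun_prop) _ _) fun s hs => (hf s hs).trans ?_
    -- One factor `e^{s-t}` offsets the larger size of `b` at earlier times, the other has integral
    -- at most one.
    have h2 : Real.exp (2 * (s - t)) = Real.exp (-t + s) * Real.exp (-t) * Real.exp s := by
      rw [← Real.exp_add, ← Real.exp_add]; ring_nf
    have h3 : Real.exp (-t) * Real.exp t = 1 := by rw [← Real.exp_add]; simp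
    calc Real.exp (2 * (s - t)) * (c * b s)
        = Real.exp (-t + s) * c * Real.exp (-t) * (Real.exp s * b s) := by rw [h2]; ring
      _ ≤ Real.exp (-t + s) * c * Real.exp (-t) * (Real.exp t * b t) :=
          mul_le_mul_of_nonneg_left (hb s hs) (by positivity)
      _ = Real.exp (-t + s) * (c * b t) * (Real.exp (-t) * Real.exp t) := by ring
      _ = _ := by rw [h3, mul_one]
  refine h1.trans ?_
  rw [intervalIntegral.integral_mul_const, integral_exp_neg_add]
  have : 0 ≤ c * b t := mul_nonneg hc hb0
  nlinarith [Real.exp_pos (-t)]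

/-- The differentiated identity is compared with its value at `L = ν`, where the integral is
explicit and yields `p₁ + ν = μ` in the limit. Each summand of the constant bounds one error term.
-/
theorem IsClassicalSolution.abs_singleton_sub_le (hp : IsClassicalSolution p)
    (hm : mean (p 0) = μ) (hμ : 1 < μ) {b : ℝ → ℝ} {C₁ C₂ : ℝ} (hC₁ : 0 < C₁)
    (hb : ∀ t, 0 ≤ t → Real.exp (-t) ≤ b t)
    (hbm : ∀ t, 0 ≤ t → ∀ s ∈ Set.Icc 0 t, Real.exp s * b s ≤ Real.exp t * b t)
    (hW : ∀ t, 0 ≤ t → Real.exp |auxLog p t - nu μ| - 1 ≤ C₁ * b t)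
    (hR : ∀ t, 0 ≤ t → Real.exp (-∫ s in (0 : ℝ)..t, auxLog p s) ≤ C₂ * b t)
    {t : ℝ} (ht : 0 ≤ t) :
    |p t 1 - (μ - nu μ)|
      ≤ (μ + μ * ((2 + μ) * Real.exp μ * C₁) + μ * Real.exp (nu μ)
          + (Real.exp μ * C₁ + μ * (Real.exp (nu μ) * C₁)) + μ * C₂
          + μ * (Real.exp (nu μ) * C₁)) * b t := by
  have hμ0 : 0 < μ := by linarith
  have hν0 := nu_pos hμ
  have hνμ := nu_le hμ
  set ν := nu μ with hν
  set L := auxLog p with hL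
  have hbt : 0 < b t := (Real.exp_pos _).trans_le (hb t ht)
  have hdev : ∀ s, 0 ≤ s → |L s - ν| ≤ C₁ * b s := fun s hs =>
    (abs_le_exp_abs_sub_one _).trans (hW s hs)
  have hL0 : ∀ s, 0 ≤ s → 0 ≤ L s := fun s hs => hp.auxLog_nonneg hs
  have hLμ : ∀ s, 0 ≤ s → L s ≤ μ := fun s hs => hp.auxLog_le hm hμ0 hs
  have hLc : ContinuousOn L (Set.uIcc 0 t) := hp.continuousOn_auxLog.mono (by
    rw [Set.uIcc_of_le ht]; exact Set.Icc_subset_Ici_self)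
  have hid := hp.genFunDeriv_identity ht
  change (p t 1 + (1 - p t 0) * L t) * Real.exp (L t) = _ + mean (p 0) *
    ∫ s in (0 : ℝ)..t, Real.exp (s - t) * (1 + Real.exp (s - t) * L s)
      * Real.exp (Real.exp (s - t) * L s) at hid
  rw [hm] at hid
  set φ : ℝ → ℝ → ℝ := fun x s => Real.exp (s - t) * (1 + Real.exp (s - t) * x)
      * Real.exp (Real.exp (s - t) * x) with hφ
  have hiL : IntervalIntegrable (fun s => φ (L s) s) MeasureTheory.volume 0 t := by
    refine ContinuousOn.intervalIntegrable ?_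
    exact (ContinuousOn.mul (by fun_prop) (continuousOn_const.add
      (ContinuousOn.mul (by fun_prop) hLc))).mul
      (Real.continuous_exp.comp_continuousOn (ContinuousOn.mul (by fun_prop) hLc))
  have hiν : IntervalIntegrable (fun s => φ ν s) MeasureTheory.volume 0 t :=
    Continuous.intervalIntegrable (by fun_prop) _ _
  have heq : ∫ s in (0 : ℝ)..t, φ ν s
      = Real.exp ν - Real.exp (-t) * Real.exp (Real.exp (-t) * ν) :=
    integral_exp_sub_mul_one_add_mul_exp ν t
  have hΔ : |(∫ s in (0 : ℝ)..t, φ (L s) s) - ∫ s in (0 : ℝ)..t, φ ν s|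
      ≤ (2 + μ) * Real.exp μ * C₁ * b t := by
    rw [← intervalIntegral.integral_sub hiL hiν]
    refine (intervalIntegral.abs_integral_le_integral_abs ht).trans ?_
    -- One discount `e^{s-t}` is a prefactor of `φ`; the second arises because `L` enters only
    -- through `e^{s-t} L`.
    refine integral_discount_le ht (by positivity) (fun s hs => ?_) (hiL.sub hiν).abs hbt.le
      (hbm t ht)
    have hE0 := Real.exp_pos (s - t)
    have hE1 : Real.exp (s - t) ≤ 1 := Real.exp_le_one_iff.2 (by linarith [hs.2])
    have h1 : ∀ x ∈ Set.Icc 0 μ, Real.exp (s - t) * x ∈ Set.Icc 0 μ := fun x hx =>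
      ⟨mul_nonneg hE0.le hx.1, (mul_le_of_le_one_left hx.1 hE1).trans hx.2⟩
    have h2 := abs_one_add_mul_exp_sub_le (h1 (L s) ⟨hL0 s hs.1, hLμ s hs.1⟩)
      (h1 ν ⟨hν0.le, hνμ⟩)
    rw [← mul_sub, abs_mul, abs_of_pos hE0] at h2
    have h3 := hdev s hs.1
    have h4 : Real.exp (2 * (s - t)) = Real.exp (s - t) * Real.exp (s - t) := by
      rw [← Real.exp_add]; ring_nf
    calc |φ (L s) s - φ ν s|
        = Real.exp (s - t) * |(1 + Real.exp (s - t) * L s) * Real.exp (Real.exp (s - t) * L s)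
          - (1 + Real.exp (s - t) * ν) * Real.exp (Real.exp (s - t) * ν)| := by
          simp only [hφ, mul_assoc]
          rw [← mul_sub, abs_mul, abs_of_pos hE0]
      _ ≤ Real.exp (s - t) * ((2 + μ) * Real.exp μ * (Real.exp (s - t) * (C₁ * b s))) := by
          gcongr
          exact h2.trans (by gcongr)
      _ = _ := by rw [h4]; ring
  have hv1 : 1 ≤ Real.exp (L t) := Real.one_le_exp (hL0 t ht)
  have hv2 : Real.exp (L t) ≤ Real.exp μ := Real.exp_le_exp.2 (hLμ t ht)
  have hvd : |Real.exp (L t) - Real.exp ν| ≤ Real.exp ν * C₁ * b t := by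
    rw [mul_assoc]
    exact (abs_exp_sub_exp_le _ _).trans
      (mul_le_mul_of_nonneg_left (hW t ht) (Real.exp_pos _).le)
  have hR0 : 0 ≤ p t 0 * Real.exp (L t) :=
    mul_nonneg ((hp.state t ht).nonneg 0) (Real.exp_pos _).le
  have hR1 : p t 0 * Real.exp (L t) ≤ C₂ * b t :=
    (hp.empty_mul_exp_auxLog_le ht).trans (hR t ht)
  have het : Real.exp (-t) ≤ 1 := Real.exp_le_one_iff.2 (by linarith)
  have hdecomp : (p t 1 - (μ - ν)) * Real.exp (L t)
      = genFunDeriv (p 0) (1 - Real.exp (-t)) * Real.exp (-t)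
        + μ * ((∫ s in (0 : ℝ)..t, φ (L s) s) - ∫ s in (0 : ℝ)..t, φ ν s)
        - μ * (Real.exp (-t) * Real.exp (Real.exp (-t) * ν))
        - ((L t - ν) * Real.exp (L t) + ν * (Real.exp (L t) - Real.exp ν))
        + L t * (p t 0 * Real.exp (L t))
        - (μ - ν) * (Real.exp (L t) - Real.exp ν) := by
    rw [heq]
    linear_combination hid
  have b1 : |genFunDeriv (p 0) (1 - Real.exp (-t)) * Real.exp (-t)| ≤ μ * b t := by
    rw [abs_mul, abs_of_pos (Real.exp_pos (-t))]
    refine mul_le_mul ?_ (hb t ht) (Real.exp_pos _).le hμ0.le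
    rw [← hm]
    refine (hp.state 0 le_rfl).abs_genFunDeriv_le ?_
    rw [abs_le]
    constructor <;> linarith [Real.exp_pos (-t)]
  have b2 : |μ * ((∫ s in (0 : ℝ)..t, φ (L s) s) - ∫ s in (0 : ℝ)..t, φ ν s)|
      ≤ μ * ((2 + μ) * Real.exp μ * C₁ * b t) := by
    rw [abs_mul, abs_of_pos hμ0]
    gcongr
  have b3 : |μ * (Real.exp (-t) * Real.exp (Real.exp (-t) * ν))| ≤ μ * (b t * Real.exp ν) := by
    rw [abs_of_nonneg (by positivity)]
    have : Real.exp (Real.exp (-t) * ν) ≤ Real.exp ν :=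
      Real.exp_le_exp.2 (mul_le_of_le_one_left hν0.le het)
    have := hb t ht
    gcongr
  have b4 : |(L t - ν) * Real.exp (L t) + ν * (Real.exp (L t) - Real.exp ν)|
      ≤ C₁ * b t * Real.exp μ + μ * (Real.exp ν * C₁ * b t) := by
    refine (abs_add_le _ _).trans (add_le_add ?_ ?_)
    · rw [abs_mul, abs_of_pos (Real.exp_pos (L t))]
      have := hdev t ht
      gcongr
    · rw [abs_mul, abs_of_pos hν0]
      gcongr
  have b5 : |L t * (p t 0 * Real.exp (L t))| ≤ μ * (C₂ * b t) := by
    rw [abs_of_nonneg (mul_nonneg (hL0 t ht) hR0)]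
    exact mul_le_mul (hLμ t ht) hR1 hR0 hμ0.le
  have b6 : |(μ - ν) * (Real.exp (L t) - Real.exp ν)| ≤ μ * (Real.exp ν * C₁ * b t) := by
    rw [abs_mul, abs_of_nonneg (by linarith)]
    exact mul_le_mul (by linarith) hvd (abs_nonneg _) hμ0.le
  have h1 : |p t 1 - (μ - ν)| ≤ |(p t 1 - (μ - ν)) * Real.exp (L t)| := by
    rw [abs_mul, abs_of_pos (Real.exp_pos (L t))]
    exact le_mul_of_one_le_right (abs_nonneg _) hv1
  refine h1.trans ?_
  rw [hdecomp]
  rw [abs_le] at b1 b2 b3 b4 b5 b6 ⊢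
  constructor <;> linarith [b1.1, b1.2, b2.1, b2.2, b3.1, b3.2, b4.1, b4.2, b5.1, b5.2, b6.1, b6.2]

/-- A decay rate for the deviation of `auxLog` passes to `auxV`, its derivative and the fraction
of sites occupied by one particle. -/
theorem exists_convergence_of_deviation_le (hμ : 1 < μ) {b : ℝ → ℝ}
    (hb : ∀ t, 0 ≤ t → Real.exp (-t) ≤ b t) (hbν : ∀ t, 0 ≤ t → Real.exp (-nu μ * t) ≤ b t)
    (hbm : ∀ t, 0 ≤ t → ∀ s ∈ Set.Icc 0 t, Real.exp s * b s ≤ Real.exp t * b t)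
    (hdev : ∃ C : ℝ, 0 < C ∧ ∀ p : ℝ → EllInfty, IsClassicalSolution p → mean (p 0) = μ →
      ∀ t : ℝ, 0 ≤ t → Real.exp |auxLog p t - nu μ| - 1 ≤ C * b t) :
    ∃ C : ℝ, 0 < C ∧ ∀ p : ℝ → EllInfty, IsClassicalSolution p → mean (p 0) = μ →
      DifferentiableOn ℝ (auxV p) (Set.Ici 0) ∧ ∀ t : ℝ, 0 ≤ t →
        y2 μ p t + |auxV p t - Real.exp (nu μ)| + |derivWithin (auxV p) (Set.Ici 0) t| ≤ C * b t ∧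
        |p t 1 - (μ - nu μ)| ≤ C * b t := by
  have hμ0 : 0 < μ := by linarith
  obtain ⟨C₁, hC₁, hW⟩ := hdev
  obtain ⟨C₂, hC₂, hR⟩ := exists_exp_neg_integral_auxLog_le hμ
  obtain ⟨C₃, hC₃, h₃⟩ : ∃ C₃ : ℝ, 0 < C₃ ∧ ∀ p : ℝ → EllInfty, IsClassicalSolution p →
      mean (p 0) = μ → ∀ t : ℝ, 0 ≤ t → |p t 1 - (μ - nu μ)| ≤ C₃ * b t :=
    ⟨_, by positivity, fun p hp hm t ht => hp.abs_singleton_sub_le hm hμ hC₁ hb hbm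
      (hW p hp hm) (fun s hs => (hR p hp hm s hs).trans
        (mul_le_mul_of_nonneg_left (hbν s hs) hC₂.le)) ht⟩
  refine ⟨2 * (Real.exp (nu μ) * C₁) + Real.exp μ * (C₃ + C₁) + C₃, by positivity,
    fun p hp hm => ⟨fun t ht => (hp.hasDerivWithinAt_auxV ht).differentiableWithinAt,
      fun t ht => ?_⟩⟩
  have hbt : 0 < b t := (Real.exp_pos _).trans_le (hb t ht)
  have hp1 := h₃ p hp hm t ht
  have hvd : ∀ s, 0 ≤ s → |auxV p s - Real.exp (nu μ)| ≤ Real.exp (nu μ) * C₁ * b s := by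
    intro s hs
    rw [mul_assoc]
    exact (abs_exp_sub_exp_le _ _).trans
      (mul_le_mul_of_nonneg_left (hW p hp hm s hs) (Real.exp_pos _).le)
  have hy : y2 μ p t ≤ Real.exp (nu μ) * C₁ * b t := by
    refine integral_discount_le ht (by positivity) (fun s hs => ?_) ?_ hbt.le (hbm t ht)
    · rw [mul_comm, show -2 * t + 2 * s = 2 * (s - t) by ring]
      exact mul_le_mul_of_nonneg_left (hvd s hs.1) (Real.exp_pos _).le
    · have hvc : ContinuousOn (auxV p) (Set.uIcc 0 t) := fun s hs =>
        ((hp.hasDerivWithinAt_auxV (by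
          rw [Set.uIcc_of_le ht] at hs; exact hs.1)).continuousWithinAt).mono (by
          rw [Set.uIcc_of_le ht]; exact Set.Icc_subset_Ici_self)
      exact ((hvc.sub continuousOn_const).abs.mul
        (by fun_prop : ContinuousOn (fun s => Real.exp (-2 * t + 2 * s)) _)).intervalIntegrable
  have hv' : |derivWithin (auxV p) (Set.Ici 0) t| ≤ Real.exp μ * (C₃ + C₁) * b t := by
    rw [(hp.hasDerivWithinAt_auxV ht).derivWithin (uniqueDiffOn_Ici 0 t ht), abs_mul, mul_assoc,
      auxV_eq, abs_of_pos (Real.exp_pos _), hp.activeMass_eq ht, hm]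
    -- `v' = v (a - L)`, and `a - L = -(p₁ - (μ - ν)) - (L - ν)`.
    have h1 : |μ - p t 1 - auxLog p t| ≤ (C₃ + C₁) * b t := by
      have h2 := (abs_le_exp_abs_sub_one _).trans (hW p hp hm t ht)
      rw [abs_le] at hp1 h2 ⊢
      constructor <;> linarith [hp1.1, hp1.2, h2.1, h2.2]
    exact mul_le_mul (Real.exp_le_exp.2 (hp.auxLog_le hm hμ0 ht)) h1 (abs_nonneg _)
      (Real.exp_pos _).le
  constructor
  · have := hvd t ht
    have : 0 < C₃ * b t := by positivity
    linarith
  · have : 0 ≤ (2 * (Real.exp (nu μ) * C₁) + Real.exp μ * (C₃ + C₁)) * b t := by positivity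
    linarith

theorem one_add_le_two_mul_japaneseBracket (t : ℝ) : 1 + t ≤ 2 * japaneseBracket t := by
  have h1 : 1 ≤ japaneseBracket t := Real.one_le_sqrt.2 (by nlinarith [sq_nonneg t])
  have h2 : t ≤ japaneseBracket t := Real.le_sqrt_of_sq_le (by linarith)
  linarith

end Convergence

end Dispersion

/-! ### The two regimes -/

theorem proposition4p8 (μ : ℝ) (hμ : 1 < μ) :
    (Dispersion.nu μ < 1 →
      ∃ C : ℝ, 0 < C ∧
        ∀ p : ℝ → Dispersion.EllInfty, Dispersion.IsClassicalSolution p →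
          Dispersion.mean (p 0) = μ →
            DifferentiableOn ℝ (Dispersion.auxV p) (Set.Ici 0) ∧
            ∀ t : ℝ, 0 ≤ t →
              Dispersion.y2 μ p t + |Dispersion.auxV p t - Real.exp (Dispersion.nu μ)|
                  + |derivWithin (Dispersion.auxV p) (Set.Ici 0) t|
                ≤ C * Real.exp (-(Dispersion.nu μ) * t) ∧
              |(p t) 1 - (μ - Dispersion.nu μ)| ≤ C * Real.exp (-(Dispersion.nu μ) * t)) ∧
    (1 ≤ Dispersion.nu μ →
      ∃ C K : ℝ, 0 < C ∧ 0 < K ∧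
        ∀ p : ℝ → Dispersion.EllInfty, Dispersion.IsClassicalSolution p →
          Dispersion.mean (p 0) = μ →
            DifferentiableOn ℝ (Dispersion.auxV p) (Set.Ici 0) ∧
            ∀ t : ℝ, 0 ≤ t →
              Dispersion.y2 μ p t + |Dispersion.auxV p t - Real.exp (Dispersion.nu μ)|
                  + |derivWithin (Dispersion.auxV p) (Set.Ici 0) t|
                ≤ C * Dispersion.japaneseBracket t ^ K * Real.exp (-t) ∧
              |(p t) 1 - (μ - Dispersion.nu μ)|
                ≤ C * Dispersion.japaneseBracket t ^ K * Real.exp (-t)) := by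
  refine ⟨fun hν => ?_, fun hν => ?_⟩
  · refine Dispersion.exists_convergence_of_deviation_le hμ
      (b := fun t => Real.exp (-(Dispersion.nu μ) * t))
      (fun t ht => Real.exp_le_exp.2 (by nlinarith)) (fun t _ => le_rfl) (fun t _ s hs => ?_)
      (Dispersion.exists_deviation_le_subcritical hμ hν)
    rw [← Real.exp_add, ← Real.exp_add]
    exact Real.exp_le_exp.2 (by nlinarith [hs.2])
  · obtain ⟨C, hC, h⟩ := Dispersion.exists_convergence_of_deviation_le hμ
      (b := fun t => Real.exp (-t) * (1 + t))
      (fun t ht => le_mul_of_one_le_right (Real.exp_pos _).le (by linarith))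
      (fun t ht => (Real.exp_le_exp.2 (by nlinarith)).trans
        (le_mul_of_one_le_right (Real.exp_pos _).le (by linarith)))
      (fun t _ s hs => by
        simp only [← mul_assoc, ← Real.exp_add, add_neg_cancel, Real.exp_zero, one_mul]
        linarith [hs.2])
      (Dispersion.exists_deviation_le_supercritical hμ hν)
    -- The loss is linear in `t`, so the exponent `K = 1` suffices; the factor `2` comes from `1 + t
    -- ≤ 2⟨t⟩`.
    refine ⟨2 * C, 1, by positivity, one_pos, fun p hp hm => ⟨(h p hp hm).1, fun t ht => ?_⟩⟩
    have hle : C * (Real.exp (-t) * (1 + t))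
        ≤ 2 * C * Dispersion.japaneseBracket t ^ (1 : ℝ) * Real.exp (-t) := by
      rw [Real.rpow_one]
      have := mul_le_mul_of_nonneg_left (Dispersion.one_add_le_two_mul_japaneseBracket t)
        (mul_pos hC (Real.exp_pos (-t))).le
      linarith
    exact ⟨((h p hp hm).2 t ht).1.trans hle, ((h p hp hm).2 t ht).2.trans hle⟩
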